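/- **Circuits.** Write $\mathbb{R}^*=\bigcup_{n\ge 0}\mathbb{R}^n$. An *extended arithmetic circuit* with $n$ inputs, $\ell$ auxiliary memory gates and $m$ outputs is a finite simple directed acyclic graph whose gates are: $n$ ordered input gates and $\ell$ ordered auxiliary memory gates (indegree $0$), real constant gates (indegree $0$), addition and multiplication gates of unbounded fan-in, $m$ ordered output gates (indegree $1$, outdegree $0$), and possibly gates computing a function $f\colon\mathbb{R}\to\mathbb{R}$ (indegree and outdegree $1$). Its size is the number of gates and its depth the length of a longest directed path. For $i\in\mathbb{N}$ and a set $\mathcal{B}$ of functions $\mathbb{R}\to\mathbb{R}$ let $\mathfrak{F}=\mathrm{FAC}^i_{\mathbb{R}}[\mathcal{B}]$: an *$\mathfrak{F}$-circuit family* is a sequence $(C_n)_{n\in\mathbb{N}}$ of such circuits, $C_n$ with $n$ inputs, of size $\mathcal{O}(n^{\mathcal{O}(1)})$ and depth $\mathcal{O}((\log n)^i)$, with function gates only for functions in $\mathcal{B}$. For a set $\mathcal{A}$ of functions put $\mathfrak{F}[\mathcal{A}]=\mathrm{FAC}^i_{\mathbb{R}}[\mathcal{B}\cup\mathcal{A}]$,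 and $\mathfrak{F}_s=\mathfrak{F}[\mathrm{sign}]$, where $\mathrm{sign}(x)=1$ if $x>0$ and $\mathrm{sign}(x)=0$ otherwise. **Recurrent circuits.** A *recurrent circuit* is an extended circuit $C$ (the underlying circuit) together with initial values of the auxiliary memory gates, one recurrent edge into each input and each auxiliary memory gate, coming from any gate that is not an output gate, an ordered set of $p$ halting gates, and a halting function $f_{\mathrm{halt}}\colon\mathbb{N}_{>0}\times\mathbb{R}^p\to\{0,1\}$. It evaluates $C$ repeatedly: if in iteration $t=1,2,\dots$ the halting function, applied to $t$ and the values of the halting gates, is $1$, then the values of the output gates are returned; otherwise every memory gate takes the value of the source of its recurrent edge and iteration $t+1$ begins. If this never stops, the result is undefined. The class $\mathrm{rec}[\mathfrak{F}']\text{-}\mathfrak{F}''$ consists of the partial functions $\mathbb{R}^*\to\mathbb{R}^*$ computed by families $(R_n)_{n\in\mathbb{N}}$ of recurrent circuits, $R_n$ with $n$ inputs, whose underlying circuits form an $\mathfrak{F}''$-circuit family, and for which there is an $\mathfrak{F}'$-circuit family $(H_k)_{k\in\mathbb{N}}$ of circuits with one output and without memory gates such that the halting function of $R_n$ is computed by $H_{p+1}$,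 where $p$ is the number of halting gates of $R_n$ and the first input is the iteration number. **Networks.** A labelled graph $\mathfrak{G}=(V,E,g_V)$ is a finite simple undirected graph with an ordered set of vertices and $g_V\colon V\to\mathbb{R}$. Its encoding $\langle\mathfrak{G}\rangle\in\mathbb{R}^{|V|^2+|V|}$ is the adjacency matrix, row by row, followed by the feature values in the order of $V$. A *$(\mathrm{rec}[t\mathfrak{F}_s]\text{-}t\mathfrak{F},\mathcal{A})$-GNN* $\textit{rec-}\mathcal{N}$ (a circuit GNN with inner recurrence only) is given by a fixed number $d\ge 1$ of layers and a periodic sequence of pairs $(f_k,\sigma_k)$, $k\in\mathbb{N}$, where $\sigma_k\in\mathcal{A}$ and $f_k$ is a real-valued partial function on $\mathbb{R}^*$ in $\mathrm{rec}[\mathfrak{F}_s]\text{-}\mathfrak{F}$ that is tail-symmetric, i.e. invariant under permutations of all arguments but the first. Put $h^{(0)}=g_V$ and, for $k\ge 1$, $$h^{(k)}(v)=\sigma_k\bigl(f_k\bigl(h^{(k-1)}(v),\{\!\{h^{(k-1)}(u)\mid \{u,v\}\in E\}\!\}\bigr)\bigr)\qquad(v\in V).$$ Then $f_{\textit{rec-}\mathcal{N}}(\mathfrak{G})=(V,E,h^{(d)})$,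 which is undefined if some value occurring in its definition is undefined. **Theorem.** Let $\mathfrak{F}=\mathrm{FAC}^i_{\mathbb{R}}[\mathcal{B}]$ for some $i\in\mathbb{N}$ and some set $\mathcal{B}$ of functions $\mathbb{R}\to\mathbb{R}$, let $\mathcal{A}$ be a set of functions $\mathbb{R}\to\mathbb{R}$, and let $\textit{rec-}\mathcal{N}$ be a $(\mathrm{rec}[t\mathfrak{F}_s]\text{-}t\mathfrak{F},\mathcal{A})$-GNN. Then there is a function $f_{\mathrm{circ}}\in\mathrm{rec}[\mathfrak{F}_s]\text{-}\mathfrak{F}_s[\mathcal{A}]$ such that for all labelled graphs $\mathfrak{G}$ $$f_{\mathrm{circ}}(\langle\mathfrak{G}\rangle)=\langle f_{\textit{rec-}\mathcal{N}}(\mathfrak{G})\rangle,$$ where one side is defined if and only if the other is. Moreover, if all layer functions $f_k$ are total, then $f_{\mathrm{circ}}$ can be chosen to be total on $\mathbb{R}^*$. -/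

import Mathlib

open Filter Asymptotics

noncomputable section

namespace RecGNN

/-! ### Extended arithmetic circuits -/

/-- Labels of the gates of an extended arithmetic circuit with `n` inputs, `ℓ` auxiliary memory
gates and `m` outputs on the set of gates `γ`, together with the predecessors of the gate.
Arithmetic gates have unbounded fan-in; as the graph is simple, the predecessors form a set. -/
inductive GateLabel (n ℓ m : ℕ) (γ : Type) : Type
  | input (j : Fin n)
  | aux (j : Fin ℓ)
  | const (c : ℝ)
  | add (s : Finset γ)
  | mul (s : Finset γ)
  | func (f : ℝ → ℝ) (h : γ)
  | output (j : Fin m) (h : γ)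

namespace GateLabel

variable {n ℓ m : ℕ} {γ : Type}

/-- The set of predecessors of a gate. -/
def preds : GateLabel n ℓ m γ → Finset γ
  | input _ => ∅
  | aux _ => ∅
  | const _ => ∅
  | add s => s
  | mul s => s
  | func _ h => {h}
  | output _ h => {h}

/-- The value of a gate, given the values `x` of the input gates, `a` of the auxiliary memory
gates, and `v` of the other gates (only the values of the predecessors are used). -/
def apply (x : Fin n → ℝ) (a : Fin ℓ → ℝ) (v : γ → ℝ) : GateLabel n ℓ m γ → ℝ
  | input j => x j
  | aux j => a j
  | const c => c
  | add s => ∑ h ∈ s, v h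
  | mul s => ∏ h ∈ s, v h
  | func f h => f (v h)
  | output _ h => v h

theorem apply_congr (x : Fin n → ℝ) (a : Fin ℓ → ℝ) {v w : γ → ℝ} (L : GateLabel n ℓ m γ)
    (hvw : ∀ h ∈ L.preds, v h = w h) : L.apply x a v = L.apply x a w := by
  cases L with
  | add s => exact Finset.sum_congr rfl hvw
  | mul s => exact Finset.prod_congr rfl hvw
  | func f h => exact congrArg f (hvw h (by simp [preds]))
  | output j h => exact hvw h (by simp [preds])
  | _ => rfl

end GateLabel

/-- An extended arithmetic circuit with `n` inputs, `ℓ` auxiliary memory gates and `m` outputs: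
a finite directed acyclic graph of gates. For `ℓ = 0` it is an (ordinary) arithmetic circuit. -/
structure ExtCircuit (n ℓ m : ℕ) where
  /-- The set of gates. -/
  Gate : Type
  fintypeGate : Fintype Gate
  label : Gate → GateLabel n ℓ m Gate
  /-- The graph is acyclic (on a finite graph this is well-foundedness of the edge relation). -/
  acyclic : WellFounded fun g h : Gate => g ∈ (label h).preds
  inGate : Fin n → Gate
  auxGate : Fin ℓ → Gate
  outGate : Fin m → Gate
  /-- There is exactly one `j`-th input gate. -/
  label_input : ∀ g j, label g = .input j ↔ g = inGate j
  /-- There is exactly one `j`-th auxiliary memory gate. -/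
  label_aux : ∀ g j, label g = .aux j ↔ g = auxGate j
  /-- There is exactly one `j`-th output gate. -/
  label_output : ∀ g j, (∃ h, label g = .output j h) ↔ g = outGate j
  /-- Output gates have outdegree zero. -/
  outGate_fanout : ∀ j g, outGate j ∉ (label g).preds
  /-- Gates for additional functions have outdegree one. -/
  func_fanout : ∀ g f p, label g = .func f p → ∃! h, g ∈ (label h).preds

attribute [instance] ExtCircuit.fintypeGate

namespace ExtCircuit

variable {n ℓ m : ℕ} (C : ExtCircuit n ℓ m)

open Classical in
/-- The value of the gate `g` on input `x` with auxiliary memory values `a`. -/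
def val (x : Fin n → ℝ) (a : Fin ℓ → ℝ) : C.Gate → ℝ :=
  C.acyclic.fix fun g v =>
    (C.label g).apply x a fun h => if hh : h ∈ (C.label g).preds then v h hh else 0

theorem val_eq (x : Fin n → ℝ) (a : Fin ℓ → ℝ) (g : C.Gate) :
    C.val x a g = (C.label g).apply x a (C.val x a) := by
  classical
  rw [val, WellFounded.fix_eq]
  refine GateLabel.apply_congr x a _ fun h hh => ?_
  simp [hh]

/-- The function computed by the circuit. -/
def eval (x : Fin n → ℝ) (a : Fin ℓ → ℝ) : Fin m → ℝ := fun j => C.val x a (C.outGate j)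

/-- The number of gates. -/
def size : ℕ := Fintype.card C.Gate

/-- The length of a longest directed path ending in the gate `g`. -/
def level : C.Gate → ℕ :=
  C.acyclic.fix fun g lev => (C.label g).preds.attach.sup fun h => lev h.1 h.2 + 1

theorem level_eq (g : C.Gate) :
    C.level g = (C.label g).preds.sup fun h => C.level h + 1 := by
  rw [level, WellFounded.fix_eq]
  exact Finset.sup_attach _ fun h => C.level h + 1

/-- The length of a longest directed path between any two gates. -/
def depth : ℕ := Finset.univ.sup C.level

/-- The additional functions used as gate types all belong to `A`. -/
def UsesOnly (A : Set (ℝ → ℝ)) : Prop := ∀ g f p, C.label g = .func f p → f ∈ A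

end ExtCircuit

/-! ### Circuit families and circuit function classes -/

/-- A family of extended arithmetic circuits, the `n`-th one having `n` inputs. -/
structure ExtFamily where
  aux : ℕ → ℕ
  out : ℕ → ℕ
  circ : ∀ n, ExtCircuit n (aux n) (out n)

/-- The data `i` and `A` of a circuit function class `FAC^i[A]` over the reals. -/
structure CircuitClass where
  depthExp : ℕ
  gates : Set (ℝ → ℝ)

/-- `𝔉[A]`: the class `𝔉` with additional gates for the functions in `A`. -/
def CircuitClass.adjoin (𝔉 : CircuitClass) (A : Set (ℝ → ℝ)) : CircuitClass :=
  ⟨𝔉.depthExp, 𝔉.gates ∪ A⟩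

/-- The sign function: `1` on positive numbers and `0` otherwise. -/
def sgn (x : ℝ) : ℝ := if 0 < x then 1 else 0

/-- `𝔉_s = 𝔉[sign]`. -/
def CircuitClass.withSign (𝔉 : CircuitClass) : CircuitClass := 𝔉.adjoin {sgn}

/-- `F` is an `𝔉`-circuit family for `𝔉 = FAC^i[A]`: size `n ^ O(1)`, depth `O((log n) ^ i)`, and
additional gates only for functions in `A`. -/
def ExtFamily.IsFamilyOf (F : ExtFamily) (𝔉 : CircuitClass) : Prop :=
  (∃ k : ℕ, (fun n : ℕ => ((F.circ n).size : ℝ)) =O[atTop] fun n : ℕ => (n : ℝ) ^ k) ∧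
  ((fun n : ℕ => ((F.circ n).depth : ℝ)) =O[atTop]
    fun n : ℕ => Real.log (n : ℝ) ^ 𝔉.depthExp) ∧
  ∀ n, (F.circ n).UsesOnly 𝔉.gates

/-! ### Recurrent arithmetic circuits -/

/-- A recurrent arithmetic circuit with `n` inputs. -/
structure RecCircuit (n : ℕ) where
  /-- Number of auxiliary memory gates. -/
  aux : ℕ
  /-- Number of outputs. -/
  out : ℕ
  /-- The underlying extended arithmetic circuit. -/
  C : ExtCircuit n aux out
  /-- Initial values of the auxiliary memory gates. -/
  init : Fin aux → ℝ
  /-- The source of the recurrent edge into the `j`-th input gate. -/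
  recIn : Fin n → C.Gate
  /-- The source of the recurrent edge into the `j`-th auxiliary memory gate. -/
  recAux : Fin aux → C.Gate
  /-- No recurrent edge leaves an output gate. -/
  recIn_ne : ∀ j k, recIn j ≠ C.outGate k
  recAux_ne : ∀ j k, recAux j ≠ C.outGate k
  /-- Number of halting gates. -/
  numHalt : ℕ
  /-- The halting gates, in order. -/
  haltGate : Fin numHalt ↪ C.Gate
  /-- The halting function; its first argument, the number of the iteration, is positive. -/
  halt : ℕ → (Fin numHalt → ℝ) → Bool

namespace RecCircuit

variable {n : ℕ} (R : RecCircuit n)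

/-- The new values of the memory gates after one iteration of the underlying circuit. -/
def step (s : (Fin n → ℝ) × (Fin R.aux → ℝ)) : (Fin n → ℝ) × (Fin R.aux → ℝ) :=
  (fun j => R.C.val s.1 s.2 (R.recIn j), fun j => R.C.val s.1 s.2 (R.recAux j))

/-- The values of the memory gates at the beginning of iteration `k + 1`. -/
def state (x : Fin n → ℝ) (k : ℕ) : (Fin n → ℝ) × (Fin R.aux → ℝ) :=
  R.step^[k] (x, R.init)

/-- Whether the circuit may halt in iteration `k + 1`. -/
def haltsAt (x : Fin n → ℝ) (k : ℕ) : Bool :=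
  R.halt (k + 1) fun j => R.C.val (R.state x k).1 (R.state x k).2 (R.haltGate j)

/-- The partial function computed by the recurrent circuit: the output of the first iteration in
which the halting function is `1`, and undefined if there is none. -/
def eval (x : Fin n → ℝ) : Part (Fin R.out → ℝ) :=
  (Nat.rfind fun k => Part.some (R.haltsAt x k)).map fun k =>
    R.C.eval (R.state x k).1 (R.state x k).2

end RecCircuit

/-- A family of recurrent arithmetic circuits, the `n`-th one having `n` inputs. -/
abbrev RecFamily : Type 1 := ∀ n, RecCircuit n

/-- The underlying family of extended arithmetic circuits. -/
def RecFamily.underlying (R : RecFamily) : ExtFamily :=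
  ⟨fun n => (R n).aux, fun n => (R n).out, fun n => (R n).C⟩

/-- The partial function `ℝ* → ℝ*` computed by a recurrent circuit family. -/
def RecFamily.eval (R : RecFamily) : List ℝ → Part (List ℝ) := fun x =>
  ((R x.length).eval x.get).map List.ofFn

/-- The halting functions of `R` are among the functions computed by an `𝔉`-circuit family `H`: a
halting function with `p` real arguments is computed by the member of `H` with `p + 1` inputs,
the first of which is the number of the iteration. -/
def RecFamily.HaltsIn (R : RecFamily) (𝔉 : CircuitClass) : Prop :=
  ∃ H : ∀ k, ExtCircuit k 0 1,
    ExtFamily.IsFamilyOf ⟨fun _ => 0, fun _ => 1, H⟩ 𝔉 ∧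
    ∀ (n i : ℕ) (v : Fin (R n).numHalt → ℝ), 1 ≤ i →
      (H ((R n).numHalt + 1)).eval (Fin.cons (i : ℝ) v) Fin.elim0 0 =
        if (R n).halt i v then 1 else 0

/-- The recurrent circuit function class `rec[𝔉halt]-𝔉`. -/
def RecClass (𝔉halt 𝔉 : CircuitClass) : Set (List ℝ → Part (List ℝ)) :=
  {f | ∃ R : RecFamily, R.underlying.IsFamilyOf 𝔉 ∧ R.HaltsIn 𝔉halt ∧ f = R.eval}

/-- Invariance under permutations of all arguments but the first. -/
def TailSymmetric {β : Type} (f : List ℝ → Part β) : Prop :=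
  ∀ (x : ℝ) (l l' : List ℝ), l.Perm l' → f (x :: l) = f (x :: l')

/-- The tail-symmetric real-valued functions of the class `rec[𝔉halt]-𝔉`. -/
def TailRecClass (𝔉halt 𝔉 : CircuitClass) : Set (List ℝ → Part ℝ) :=
  {f | TailSymmetric f ∧ (fun x => (f x).map fun y => [y]) ∈ RecClass 𝔉halt 𝔉}

/-! ### Labelled graphs and recurrent circuit graph neural networks -/

/-- A finite undirected graph on an ordered set of vertices with real feature values. -/
structure LGraph where
  card : ℕ
  graph : SimpleGraph (Fin card)
  feat : Fin card → ℝ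

namespace LGraph

open Classical in
/-- The neighbours of `v`, in the order of the vertices. -/
def nbrs (G : LGraph) (v : Fin G.card) : List (Fin G.card) :=
  (List.finRange G.card).filter fun w => G.graph.Adj v w

open Classical in
/-- The encoding of a labelled graph: the entries of the adjacency matrix, row by row, followed by
the feature values. -/
def encode (G : LGraph) : List ℝ :=
  ((List.finRange G.card).flatMap fun v =>
    (List.finRange G.card).map fun w => if G.graph.Adj v w then (1 : ℝ) else 0) ++
  (List.finRange G.card).map G.feat

end LGraph

/-- A recurrent circuit graph neural network. The layer functions and activation functions are
assigned periodically, and the halting function is invariant under permutations of the features. -/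
structure RecCGNN where
  layer : ℕ → (List ℝ → Part ℝ)
  act : ℕ → ℝ → ℝ
  period : ℕ
  period_pos : 0 < period
  layer_periodic : Function.Periodic layer period
  act_periodic : Function.Periodic act period
  /-- The halting function; its first argument, the number of the layer, is positive. -/
  halt : ℕ → List ℝ → Bool
  halt_perm : ∀ (i : ℕ) (l l' : List ℝ), l.Perm l' → halt i l = halt i l'

namespace RecCGNN

variable (N : RecCGNN)

/-- One layer: the feature value of every vertex `v` is replaced by the activation function applied
to the layer function of the feature values of `v` and of its neighbours. The result is undefined
if the layer function is undefined at some vertex. -/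
def layerStep (G : LGraph) (i : ℕ) (h : Fin G.card → ℝ) : Part (Fin G.card → ℝ) where
  Dom := ∀ v, (N.layer i (h v :: (G.nbrs v).map h)).Dom
  get := fun hd v => N.act i ((N.layer i (h v :: (G.nbrs v).map h)).get (hd v))

/-- The feature values after `i` layers. -/
def feats (G : LGraph) : ℕ → Part (Fin G.card → ℝ)
  | 0 => Part.some G.feat
  | i + 1 => (feats G i).bind (N.layerStep G (i + 1))

/-- The partial function on labelled graphs computed by the network: the graph is unchanged, and
the features are those after the first layer at which the halting function is `1`. -/
def eval : LGraph → Part LGraph := fun G =>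
  (Nat.rfind fun k => (N.feats G (k + 1)).map fun h => N.halt (k + 1) (List.ofFn h)).bind fun k =>
    (N.feats G (k + 1)).map fun h => { G with feat := h }

/-- `N` is a `(rec[t𝔉_s]-t𝔉, A)`-GNN, i.e. a circuit graph neural network with inner recurrence
only: its layer functions are tail-symmetric functions of `rec[𝔉_s]-𝔉`, its activation functions
are in `A`, and it halts at a fixed layer. -/
def IsInnerRecurrent (𝔉 : CircuitClass) (A : Set (ℝ → ℝ)) : Prop :=
  (∀ i, N.layer i ∈ TailRecClass 𝔉.withSign 𝔉) ∧ (∀ i, N.act i ∈ A) ∧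
  ∃ d : ℕ, 1 ≤ d ∧ ∀ i l, N.halt i l = decide (i = d)

end RecCGNN

end RecGNN

end

/-! A recurrent circuit may iterate as often as it likes, so one circuit can host the inner
recurrent computations of all layers and all vertices side by side and let each layer wait for the
previous one. For every layer, every vertex `v` and every conceivable degree of `v` it holds a copy
of the layer's circuit of the matching arity, with its memory gates turned into registers. There are
`d * n * (n + 1)` copies, hence polynomially many. Which degree is the right one depends on the
input, so the copies with the wrong degree also run, and a sign test on the degree masks their
results.

Each copy is driven by an iteration counter, a running flag, a latched halting flag and a result
register. Its halting circuit is evaluated inside the underlying circuit; hence the sign gates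
there. The layers are synchronised by one signal, the product over the vertices of the halting flags
of the correct copies. It starts the next layer and, after the last layer, makes a single halting
gate positive, so the outer halting function is just the sign of that gate. If some layer function
is undefined at a vertex, its flag stays `0` and the circuit never stops. No running time has to be
estimated. `Control.mem_after`, `Control.exists_done` and `Control.done_eq_zero` describe one copy;
`Layers.Implements.simulation` is the induction on layers.

Depth grows only by a constant factor: one iteration evaluates the simulated circuits, then their
halting circuits, then control formulas of constant depth, since features of earlier layers are read
from registers. To avoid building circuits by hand, everything is written as a system of small
formulas (`Netlist`) and compiled by `Netlist.Ok.toCircuit`. The bounds are collected in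
`Layers.Uses.isFamilyOf_family`.

For totality, an arbitrary tuple is read as a directed graph, with edges where the matrix entry is
positive and surplus entries ignored. The simulation is therefore proved for arbitrary relations
(`RecCGNN.relFeats`), and total layer functions make it stop on every input. -/

noncomputable section

namespace RecGNN

/-! ### Arithmetic formulas -/

/-- Arithmetic formulas with variables in `V`, with gates of unbounded fan-in. -/
inductive Formula (V : Type) : Type 1
  | var (v : V)
  | const (c : ℝ)
  | add (ι : Type) (inst : Fintype ι) (F : ι → Formula V)
  | mul (ι : Type) (inst : Fintype ι) (F : ι → Formula V)
  | func (f : ℝ → ℝ) (F : Formula V)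

namespace Formula

variable {V : Type}

/-- The value of a formula. -/
def eval (ρ : V → ℝ) : Formula V → ℝ
  | var v => ρ v
  | const c => c
  | add _ _ F => ∑ i, (F i).eval ρ
  | mul _ _ F => ∏ i, (F i).eval ρ
  | func f F => f (F.eval ρ)

/-- The sum of a finite family of formulas. -/
def sum {ι : Type} [inst : Fintype ι] (F : ι → Formula V) : Formula V := add ι inst F

/-- The product of a finite family of formulas. -/
def prod {ι : Type} [inst : Fintype ι] (F : ι → Formula V) : Formula V := mul ι inst F

instance : Add (Formula V) := ⟨fun F G => sum fun b => cond b F G⟩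

instance : Mul (Formula V) := ⟨fun F G => prod fun b => cond b F G⟩

instance : Sub (Formula V) := ⟨fun F G => F + const (-1) * G⟩

@[simp] theorem eval_var (ρ : V → ℝ) (v : V) : (var v).eval ρ = ρ v := rfl

@[simp] theorem eval_const (ρ : V → ℝ) (c : ℝ) : (const c).eval ρ = c := rfl

@[simp] theorem eval_func (ρ : V → ℝ) (f : ℝ → ℝ) (F : Formula V) :
    (func f F).eval ρ = f (F.eval ρ) := rfl

@[simp] theorem eval_sum (ρ : V → ℝ) {ι : Type} [Fintype ι] (F : ι → Formula V) :
    (sum F).eval ρ = ∑ i, (F i).eval ρ := rfl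

@[simp] theorem eval_prod (ρ : V → ℝ) {ι : Type} [Fintype ι] (F : ι → Formula V) :
    (prod F).eval ρ = ∏ i, (F i).eval ρ := rfl

@[simp] theorem eval_add (ρ : V → ℝ) (F G : Formula V) :
    (F + G).eval ρ = F.eval ρ + G.eval ρ := by
  change (sum fun b => cond b F G).eval ρ = _
  simp

@[simp] theorem eval_mul (ρ : V → ℝ) (F G : Formula V) :
    (F * G).eval ρ = F.eval ρ * G.eval ρ := by
  change (prod fun b => cond b F G).eval ρ = _
  simp

@[simp] theorem eval_sub (ρ : V → ℝ) (F G : Formula V) :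
    (F - G).eval ρ = F.eval ρ - G.eval ρ := by
  change (F + const (-1) * G).eval ρ = _
  simp [sub_eq_add_neg]

/-- The formula `F` uses only functions in `A`, has fan-in at most `W + 2` and depth at most `c`,
and its variables satisfy `P`. -/
def Ok (A : Set (ℝ → ℝ)) (W : ℕ) (P : V → Prop) : ℕ → Formula V → Prop
  | _, var v => P v
  | _, const _ => True
  | 0, add _ _ _ => False
  | c + 1, add ι _ F => Fintype.card ι ≤ W + 2 ∧ ∀ i, Ok A W P c (F i)
  | 0, mul _ _ _ => False
  | c + 1, mul ι _ F => Fintype.card ι ≤ W + 2 ∧ ∀ i, Ok A W P c (F i)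
  | 0, func _ _ => False
  | c + 1, func f F => f ∈ A ∧ Ok A W P c F

/-! ### Closure of the fan-in and depth bounds under formula operations -/

section Ok

variable {A : Set (ℝ → ℝ)} {W : ℕ} {P : V → Prop} {c : ℕ}

theorem ok_var {v : V} (h : P v) : Ok A W P c (var v) := by cases c <;> exact h

theorem ok_const (r : ℝ) : Ok A W P c (const r : Formula V) := by cases c <;> trivial

theorem ok_sum {ι : Type} [Fintype ι] {F : ι → Formula V} (hW : Fintype.card ι ≤ W + 2)
    (h : ∀ i, Ok A W P c (F i)) : Ok A W P (c + 1) (sum F) := ⟨hW, h⟩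

theorem ok_prod {ι : Type} [Fintype ι] {F : ι → Formula V} (hW : Fintype.card ι ≤ W + 2)
    (h : ∀ i, Ok A W P c (F i)) : Ok A W P (c + 1) (prod F) := ⟨hW, h⟩

theorem ok_func {f : ℝ → ℝ} {F : Formula V} (hf : f ∈ A) (h : Ok A W P c F) :
    Ok A W P (c + 1) (func f F) := ⟨hf, h⟩

theorem Ok.add {F G : Formula V} (hF : Ok A W P c F) (hG : Ok A W P c G) :
    Ok A W P (c + 1) (F + G) :=
  ok_sum (by simp) fun b => by cases b <;> assumption

theorem Ok.mul {F G : Formula V} (hF : Ok A W P c F) (hG : Ok A W P c G) :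
    Ok A W P (c + 1) (F * G) :=
  ok_prod (by simp) fun b => by cases b <;> assumption

theorem Ok.mono {W' : ℕ} {P' : V → Prop} {c' : ℕ} (hW : W ≤ W') (hP : ∀ v, P v → P' v)
    (hc : c ≤ c') {F : Formula V} (hF : Ok A W P c F) : Ok A W' P' c' F := by
  induction F generalizing c c' with
  | var v => cases c <;> cases c' <;> exact hP _ hF
  | const r => exact ok_const r
  | add ι inst F ih =>
    rcases c with - | c
    · exact hF.elim
    · rcases c' with - | c'
      · omega
      · exact ⟨hF.1.trans (by omega), fun i => ih i (by omega) (hF.2 i)⟩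
  | mul ι inst F ih =>
    rcases c with - | c
    · exact hF.elim
    · rcases c' with - | c'
      · omega
      · exact ⟨hF.1.trans (by omega), fun i => ih i (by omega) (hF.2 i)⟩
  | func f F ih =>
    rcases c with - | c
    · exact hF.elim
    · rcases c' with - | c'
      · omega
      · exact ⟨hF.1, ih (by omega) hF.2⟩

theorem Ok.deepen {c' : ℕ} {F : Formula V} (hF : Ok A W P c F) (hc : c ≤ c') : Ok A W P c' F :=
  hF.mono le_rfl (fun _ => id) hc

/-- Subtraction costs two levels because it is an addition of a product with the constant `-1`. -/
theorem Ok.sub {F G : Formula V} (hF : Ok A W P c F) (hG : Ok A W P c G) :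
    Ok A W P (c + 2) (F - G) :=
  (hF.deepen (Nat.le_succ c)).add ((ok_const _).mul hG)

end Ok

/-- Renaming of variables. -/
def rename {V' : Type} (e : V → V') : Formula V → Formula V'
  | var v => var (e v)
  | const c => const c
  | add ι inst F => add ι inst fun i => (F i).rename e
  | mul ι inst F => mul ι inst fun i => (F i).rename e
  | func f F => func f (F.rename e)

@[simp] theorem eval_rename {V' : Type} (e : V → V') (ρ : V' → ℝ) (F : Formula V) :
    (F.rename e).eval ρ = F.eval (ρ ∘ e) := by
  induction F with
  | var v => rfl
  | const c => rfl
  | add ι inst F ih => exact Finset.sum_congr rfl fun i _ => ih i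
  | mul ι inst F ih => exact Finset.prod_congr rfl fun i _ => ih i
  | func f F ih => exact congrArg f ih

theorem Ok.rename {V' : Type} {A : Set (ℝ → ℝ)} {W c : ℕ} {P : V → Prop} {P' : V' → Prop}
    {e : V → V'} (he : ∀ v, P v → P' (e v)) {F : Formula V} (hF : Ok A W P c F) :
    Ok A W P' c (F.rename e) := by
  induction F generalizing c with
  | var v => cases c <;> exact he _ hF
  | const r => exact ok_const r
  | add ι inst F ih =>
    rcases c with - | c
    · exact hF.elim
    · exact ⟨hF.1, fun i => ih i (hF.2 i)⟩
  | mul ι inst F ih =>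
    rcases c with - | c
    · exact hF.elim
    · exact ⟨hF.1, fun i => ih i (hF.2 i)⟩
  | func f F ih =>
    rcases c with - | c
    · exact hF.elim
    · exact ⟨hF.1, ih hF.2⟩

/-! ### Positions in a formula -/

/-- The positions (nodes) of a formula. -/
def Pos : Formula V → Type
  | var _ => Unit
  | const _ => Unit
  | add _ _ F => Option (Σ i, (F i).Pos)
  | mul _ _ F => Option (Σ i, (F i).Pos)
  | func _ F => Option F.Pos

instance fintypePos : (F : Formula V) → Fintype F.Pos
  | var _ => inferInstanceAs (Fintype Unit)
  | const _ => inferInstanceAs (Fintype Unit)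
  | add _ _ F =>
    letI := fun i => fintypePos (F i)
    inferInstanceAs (Fintype (Option (Σ i, (F i).Pos)))
  | mul _ _ F =>
    letI := fun i => fintypePos (F i)
    inferInstanceAs (Fintype (Option (Σ i, (F i).Pos)))
  | func _ F =>
    letI := fintypePos F
    inferInstanceAs (Fintype (Option F.Pos))

/-- The root of a formula. -/
def root : (F : Formula V) → F.Pos
  | var _ => ()
  | const _ => ()
  | add _ _ _ => none
  | mul _ _ _ => none
  | func _ _ => none

/-- The parent of a position. -/
def parent : (F : Formula V) → F.Pos → Option F.Pos
  | var _, _ => none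
  | const _, _ => none
  | add _ _ _, none => none
  | add _ _ F, some ⟨i, p⟩ => some (((F i).parent p).map (Sigma.mk i))
  | mul _ _ _, none => none
  | mul _ _ F, some ⟨i, p⟩ => some (((F i).parent p).map (Sigma.mk i))
  | func _ _, none => none
  | func _ F, some p => some (F.parent p)

/-- The distance of a position from the root. -/
def distRoot : (F : Formula V) → F.Pos → ℕ
  | var _, _ => 0
  | const _, _ => 0
  | add _ _ _, none => 0
  | add _ _ F, some ⟨i, p⟩ => (F i).distRoot p + 1
  | mul _ _ _, none => 0
  | mul _ _ F, some ⟨i, p⟩ => (F i).distRoot p + 1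
  | func _ _, none => 0
  | func _ F, some p => F.distRoot p + 1

/-- The value of the subformula at a position. -/
def value (ρ : V → ℝ) : (F : Formula V) → F.Pos → ℝ
  | var v, _ => ρ v
  | const c, _ => c
  | add _ _ F, none => ∑ i, (F i).eval ρ
  | add _ _ F, some ⟨i, p⟩ => (F i).value ρ p
  | mul _ _ F, none => ∏ i, (F i).eval ρ
  | mul _ _ F, some ⟨i, p⟩ => (F i).value ρ p
  | func f F, none => f (F.eval ρ)
  | func _ F, some p => F.value ρ p

open Classical in
/-- The labels of the gates of a circuit evaluating the formula, where the position `p` is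
represented by the gate `e p` and the value of the variable `v` is found in the gate `src v`. -/
def label {n ℓ m : ℕ} {Γ : Type} (src : V → Γ) :
    (F : Formula V) → (F.Pos → Γ) → F.Pos → GateLabel n ℓ m Γ
  -- Each occurrence of a variable gets its own copying gate. Predecessors form a set, so in `F + F`
  -- or `F * F` the two operands must be different gates.
  | var v, _, _ => .add {src v}
  | const c, _, _ => .const c
  | add _ _ F, e, none => .add (Finset.univ.image fun i => e (some ⟨i, (F i).root⟩))
  | add _ _ F, e, some ⟨i, p⟩ => (F i).label src (fun q => e (some ⟨i, q⟩)) p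
  | mul _ _ F, e, none => .mul (Finset.univ.image fun i => e (some ⟨i, (F i).root⟩))
  | mul _ _ F, e, some ⟨i, p⟩ => (F i).label src (fun q => e (some ⟨i, q⟩)) p
  | func f F, e, none => .func f (e (some F.root))
  | func _ F, e, some p => F.label src (fun q => e (some q)) p

@[simp] theorem value_root (ρ : V → ℝ) (F : Formula V) : F.value ρ F.root = F.eval ρ := by
  cases F <;> rfl

theorem parent_root (F : Formula V) : F.parent F.root = none := by
  cases F <;> rfl

theorem parent_eq_none {F : Formula V} {p : F.Pos} (h : F.parent p = none) : p = F.root := by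
  cases F with
  | var v => rfl
  | const c => rfl
  | add ι inst F => rcases p with - | ⟨i, p⟩ <;> first | rfl | cases h
  | mul ι inst F => rcases p with - | ⟨i, p⟩ <;> first | rfl | cases h
  | func f F => rcases p with - | p <;> first | rfl | cases h

theorem distRoot_root (F : Formula V) : F.distRoot F.root = 0 := by
  cases F <;> rfl

theorem distRoot_of_parent {F : Formula V} {p q : F.Pos} (h : F.parent q = some p) :
    F.distRoot q = F.distRoot p + 1 := by
  induction F with
  | var v => cases h
  | const c => cases h
  | add ι inst F ih =>
    rcases q with - | ⟨i, q⟩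
    · cases h
    · have h' : ((F i).parent q).map (Sigma.mk i) = p := Option.some.inj h
      subst h'
      cases hq : (F i).parent q with
      | none =>
        obtain rfl := parent_eq_none hq
        exact congrArg (· + 1) (distRoot_root _)
      | some r => exact congrArg (· + 1) (ih i hq)
  | mul ι inst F ih =>
    rcases q with - | ⟨i, q⟩
    · cases h
    · have h' : ((F i).parent q).map (Sigma.mk i) = p := Option.some.inj h
      subst h'
      cases hq : (F i).parent q with
      | none =>
        obtain rfl := parent_eq_none hq
        exact congrArg (· + 1) (distRoot_root _)
      | some r => exact congrArg (· + 1) (ih i hq)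
  | func f F ih =>
    rcases q with - | q
    · cases h
    · have h' : F.parent q = p := Option.some.inj h
      subst h'
      cases hq : F.parent q with
      | none =>
        obtain rfl := parent_eq_none hq
        exact congrArg (· + 1) (distRoot_root _)
      | some r => exact congrArg (· + 1) (ih hq)

/-! ### Size, edges and correctness of the tree of a formula -/

section

variable {A : Set (ℝ → ℝ)} {W : ℕ} {P : V → Prop}

theorem Ok.distRoot_le {c : ℕ} {F : Formula V} (hF : Ok A W P c F) (p : F.Pos) :
    F.distRoot p ≤ c := by
  induction F generalizing c with
  | var v => exact Nat.zero_le _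
  | const r => exact Nat.zero_le _
  | add ι inst F ih =>
    rcases c with - | c
    · exact hF.elim
    rcases p with - | ⟨i, p⟩
    · exact Nat.zero_le _
    · exact Nat.succ_le_succ (ih i (hF.2 i) p)
  | mul ι inst F ih =>
    rcases c with - | c
    · exact hF.elim
    rcases p with - | ⟨i, p⟩
    · exact Nat.zero_le _
    · exact Nat.succ_le_succ (ih i (hF.2 i) p)
  | func f F ih =>
    rcases c with - | c
    · exact hF.elim
    rcases p with - | p
    · exact Nat.zero_le _
    · exact Nat.succ_le_succ (ih hF.2 p)

/-- The root is paid for by the gap between the fan-in `W + 2` and the base `W + 3`: with `1 ≤ b`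
one has `(W + 2) * b + 1 ≤ (W + 3) * b`. -/
theorem card_option_sigma_le {ι : Type} [Fintype ι] {β : ι → Type} [∀ i, Fintype (β i)] {W c : ℕ}
    (hι : Fintype.card ι ≤ W + 2) (hβ : ∀ i, Fintype.card (β i) ≤ (W + 3) ^ c) :
    Fintype.card (Option (Σ i, β i)) ≤ (W + 3) ^ (c + 1) := by
  rw [Fintype.card_option, Fintype.card_sigma]
  have h1 : ∑ i, Fintype.card (β i) ≤ Fintype.card ι * (W + 3) ^ c := by
    simpa using Finset.sum_le_card_nsmul Finset.univ _ _ fun i _ => hβ i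
  have h2 : Fintype.card ι * (W + 3) ^ c ≤ (W + 2) * (W + 3) ^ c := Nat.mul_le_mul_right _ hι
  have h3 : 1 ≤ (W + 3) ^ c := Nat.one_le_pow _ _ (by omega)
  rw [pow_succ]
  nlinarith

theorem Ok.card_le {c : ℕ} {F : Formula V} (hF : Ok A W P c F) :
    Fintype.card F.Pos ≤ (W + 3) ^ c := by
  induction F generalizing c with
  | var v => exact Nat.one_le_pow _ _ (by omega)
  | const r => exact Nat.one_le_pow _ _ (by omega)
  | add ι inst F ih =>
    rcases c with - | c
    · exact hF.elim
    · exact card_option_sigma_le hF.1 fun i => ih i (hF.2 i)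
  | mul ι inst F ih =>
    rcases c with - | c
    · exact hF.elim
    · exact card_option_sigma_le hF.1 fun i => ih i (hF.2 i)
  | func f F ih =>
    rcases c with - | c
    · exact hF.elim
    · have h : Fintype.card (func f F).Pos = Fintype.card F.Pos + 1 :=
        Fintype.card_option (α := F.Pos)
      have h1 := ih hF.2
      have h3 : 1 ≤ (W + 3) ^ c := Nat.one_le_pow _ _ (by omega)
      rw [h, pow_succ]
      nlinarith

variable {n ℓ m : ℕ} {Γ : Type} {src : V → Γ}

/-- Edges inside the tree run from child to parent, and only variable leaves look outside it.
Acyclicity and the fan-out conditions of the compiled circuit both rest on this dichotomy. -/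
theorem Ok.of_mem_preds {c : ℕ} {F : Formula V} (hF : Ok A W P c F) {e : F.Pos → Γ} {p : F.Pos}
    {x : Γ} (hx : x ∈ (F.label (n := n) (ℓ := ℓ) (m := m) src e p).preds) :
    (∃ q, x = e q ∧ F.parent q = some p) ∨ ∃ v, P v ∧ x = src v := by
  classical
  induction F generalizing c with
  | var v =>
    have hv : P v := by cases c <;> exact hF
    exact Or.inr ⟨v, hv, Finset.mem_singleton.1 hx⟩
  | const r => cases hx
  | add ι inst F ih =>
    rcases c with - | c
    · exact hF.elim
    rcases p with - | ⟨i, p⟩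
    · obtain ⟨i, -, rfl⟩ := Finset.mem_image.1 hx
      exact Or.inl ⟨_, rfl, by
        change some (((F i).parent _).map (Sigma.mk (β := fun i => (F i).Pos) i)) = _
        rw [parent_root]
        rfl⟩
    · obtain ⟨q, rfl, hq⟩ | h := ih i (hF.2 i) hx
      · exact Or.inl ⟨_, rfl, by
          change some (((F i).parent _).map (Sigma.mk (β := fun i => (F i).Pos) i)) = _
          rw [hq]
          rfl⟩
      · exact Or.inr h
  | mul ι inst F ih =>
    rcases c with - | c
    · exact hF.elim
    rcases p with - | ⟨i, p⟩
    · obtain ⟨i, -, rfl⟩ := Finset.mem_image.1 hx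
      exact Or.inl ⟨_, rfl, by
        change some (((F i).parent _).map (Sigma.mk (β := fun i => (F i).Pos) i)) = _
        rw [parent_root]
        rfl⟩
    · obtain ⟨q, rfl, hq⟩ | h := ih i (hF.2 i) hx
      · exact Or.inl ⟨_, rfl, by
          change some (((F i).parent _).map (Sigma.mk (β := fun i => (F i).Pos) i)) = _
          rw [hq]
          rfl⟩
      · exact Or.inr h
  | func f F ih =>
    rcases c with - | c
    · exact hF.elim
    rcases p with - | p
    · obtain rfl := Finset.mem_singleton.1 hx
      exact Or.inl ⟨_, rfl, congrArg some (parent_root _)⟩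
    · obtain ⟨q, rfl, hq⟩ | h := ih hF.2 hx
      · exact Or.inl ⟨_, rfl, congrArg some hq⟩
      · exact Or.inr h

/-- Supplies the existence half of the claim that a gate inside a formula has a unique successor. -/
theorem mem_preds_of_parent {F : Formula V} {e : F.Pos → Γ} {p q : F.Pos}
    (h : F.parent q = some p) : e q ∈ (F.label (n := n) (ℓ := ℓ) (m := m) src e p).preds := by
  classical
  induction F with
  | var v => cases h
  | const c => cases h
  | add ι inst F ih =>
    rcases q with - | ⟨i, q⟩
    · cases h
    · have h' : ((F i).parent q).map (Sigma.mk i) = p := Option.some.inj h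
      subst h'
      cases hq : (F i).parent q with
      | none =>
        obtain rfl := parent_eq_none hq
        exact Finset.mem_image.2 ⟨i, Finset.mem_univ _, rfl⟩
      | some r => exact ih i hq
  | mul ι inst F ih =>
    rcases q with - | ⟨i, q⟩
    · cases h
    · have h' : ((F i).parent q).map (Sigma.mk i) = p := Option.some.inj h
      subst h'
      cases hq : (F i).parent q with
      | none =>
        obtain rfl := parent_eq_none hq
        exact Finset.mem_image.2 ⟨i, Finset.mem_univ _, rfl⟩
      | some r => exact ih i hq
  | func f F ih =>
    rcases q with - | q
    · cases h
    · have h' : F.parent q = p := Option.some.inj h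
      subst h'
      cases hq : F.parent q with
      | none =>
        obtain rfl := parent_eq_none hq
        exact Finset.mem_singleton_self _
      | some r => exact ih hq

theorem Ok.mem_of_label_eq_func {c : ℕ} {F : Formula V} (hF : Ok A W P c F) {e : F.Pos → Γ}
    {p : F.Pos} {f : ℝ → ℝ} {x : Γ}
    (h : F.label (n := n) (ℓ := ℓ) (m := m) src e p = .func f x) : f ∈ A := by
  induction F generalizing c with
  | var v => cases h
  | const r => cases h
  | add ι inst F ih =>
    rcases c with - | c
    · exact hF.elim
    rcases p with - | ⟨i, p⟩
    · cases h
    · exact ih i (hF.2 i) h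
  | mul ι inst F ih =>
    rcases c with - | c
    · exact hF.elim
    rcases p with - | ⟨i, p⟩
    · cases h
    · exact ih i (hF.2 i) h
  | func f F ih =>
    rcases c with - | c
    · exact hF.elim
    rcases p with - | p
    · cases h
      exact hF.1
    · exact ih hF.2 h

theorem label_ne (F : Formula V) (e : F.Pos → Γ) (p : F.Pos) :
    (∀ j, F.label (n := n) (ℓ := ℓ) (m := m) src e p ≠ .input j) ∧
    (∀ j, F.label (n := n) (ℓ := ℓ) (m := m) src e p ≠ .aux j) ∧
    ∀ j x, F.label (n := n) (ℓ := ℓ) (m := m) src e p ≠ .output j x := by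
  induction F with
  | var v => exact ⟨fun _ h => (by cases h), fun _ h => (by cases h), fun _ _ h => (by cases h)⟩
  | const r => exact ⟨fun _ h => (by cases h), fun _ h => (by cases h), fun _ _ h => (by cases h)⟩
  | add ι inst F ih =>
    rcases p with - | ⟨i, p⟩
    · exact ⟨fun _ h => (by cases h), fun _ h => (by cases h), fun _ _ h => (by cases h)⟩
    · exact ih i _ p
  | mul ι inst F ih =>
    rcases p with - | ⟨i, p⟩
    · exact ⟨fun _ h => (by cases h), fun _ h => (by cases h), fun _ _ h => (by cases h)⟩
    · exact ih i _ p
  | func f F ih =>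
    rcases p with - | p
    · exact ⟨fun _ h => (by cases h), fun _ h => (by cases h), fun _ _ h => (by cases h)⟩
    · exact ih _ p

/-- Injectivity of `e` is what keeps sums and products correct: distinct operands must not be
identified in the predecessor set. -/
theorem apply_label {F : Formula V} {e : F.Pos → Γ} (he : Function.Injective e) {ρ : V → ℝ}
    {w : Γ → ℝ} (hsrc : ∀ v, w (src v) = ρ v) (hw : ∀ p, w (e p) = F.value ρ p) (x : Fin n → ℝ)
    (a : Fin ℓ → ℝ) (p : F.Pos) :
    (F.label (m := m) src e p).apply x a w = F.value ρ p := by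
  classical
  induction F with
  | var v => exact (Finset.sum_singleton _ _).trans (hsrc v)
  | const r => rfl
  | add ι inst F ih =>
    rcases p with - | ⟨i, p⟩
    · refine (Finset.sum_image fun i _ j _ hij => ?_).trans
        (Finset.sum_congr rfl fun i _ => (hw _).trans (value_root _ _))
      exact congrArg Sigma.fst (Option.some.inj (he hij))
    · refine ih i (fun q q' h => ?_) (fun q => hw (some ⟨i, q⟩)) p
      exact eq_of_heq (Sigma.mk.inj (Option.some.inj (he h))).2
  | mul ι inst F ih =>
    rcases p with - | ⟨i, p⟩
    · refine (Finset.prod_image fun i _ j _ hij => ?_).trans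
        (Finset.prod_congr rfl fun i _ => (hw _).trans (value_root _ _))
      exact congrArg Sigma.fst (Option.some.inj (he hij))
    · refine ih i (fun q q' h => ?_) (fun q => hw (some ⟨i, q⟩)) p
      exact eq_of_heq (Sigma.mk.inj (Option.some.inj (he h))).2
  | func f F ih =>
    rcases p with - | p
    · exact congrArg f ((hw _).trans (value_root _ _))
    · exact ih (fun q q' h => Option.some.inj (he h)) (fun q => hw (some q)) p

end

end Formula

/-! ### Compiling systems of formulas to circuits -/

namespace ExtCircuit

variable {n ℓ m : ℕ} (C : ExtCircuit n ℓ m)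

/-- Acyclicity makes the solution of the gate equations unique, so a circuit can be verified by
exhibiting a candidate valuation. -/
theorem eq_val {x : Fin n → ℝ} {a : Fin ℓ → ℝ} {w : C.Gate → ℝ}
    (hw : ∀ g, w g = (C.label g).apply x a w) : w = C.val x a := by
  funext g
  induction g using C.acyclic.induction with
  | _ g ih =>
    rw [hw, C.val_eq]
    exact GateLabel.apply_congr x a _ ih

theorem level_le {r : C.Gate → ℕ} (hr : ∀ g h, g ∈ (C.label h).preds → r g < r h) (g : C.Gate) :
    C.level g ≤ r g := by
  induction g using C.acyclic.induction with
  | _ g ih =>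
    rw [C.level_eq]
    exact Finset.sup_le fun h hh => (Nat.succ_le_succ (ih h hh)).trans (hr h g hh)

theorem level_lt {g h : C.Gate} (hg : g ∈ (C.label h).preds) : C.level g < C.level h := by
  rw [C.level_eq h]
  exact Nat.lt_of_succ_le (Finset.le_sup (f := fun h => C.level h + 1) hg)

theorem level_le_depth (g : C.Gate) : C.level g ≤ C.depth := Finset.le_sup (Finset.mem_univ g)

/-- Every auxiliary gate of a simulated circuit becomes a register, so their number has to be
polynomial as well. -/
theorem aux_le_size : ℓ ≤ C.size := by
  have h : Function.Injective C.auxGate := fun i j hij => by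
    have h1 := (C.label_aux _ i).2 rfl
    have h2 := (C.label_aux _ j).2 rfl
    rw [hij, h2] at h1
    cases h1
    rfl
  simpa [size] using Fintype.card_le_of_injective _ h

end ExtCircuit

/-- A system of formulas, one for each wire, which refer to input gates, auxiliary memory gates and
other wires. The outputs are the values of selected wires. -/
structure Netlist (n ℓ m : ℕ) where
  Wire : Type
  fintypeWire : Fintype Wire
  form : Wire → Formula (Fin n ⊕ Fin ℓ ⊕ Wire)
  lev : Wire → ℕ
  out : Fin m → Wire

attribute [instance] Netlist.fintypeWire

namespace Netlist

variable {n ℓ m : ℕ} (S : Netlist n ℓ m)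

/-- The references of the formula of the wire `g` are to memory gates and to lower wires. -/
def Lower (g : S.Wire) : Fin n ⊕ Fin ℓ ⊕ S.Wire → Prop
  | .inr (.inr h) => S.lev h < S.lev g
  | _ => True

/-- The formulas of a system use only functions in `A`, have fan-in at most `W + 2` and depth at
most `c`; the system is acyclic and has at most `D + 1` levels. -/
structure Ok (A : Set (ℝ → ℝ)) (W c D : ℕ) : Prop where
  form : ∀ g, (S.form g).Ok A W (S.Lower g) c
  lev_le : ∀ g, S.lev g ≤ D

/-- Input gates, auxiliary memory gates, for each wire the positions of its formula together with
one additional gate, and output gates. -/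
abbrev Gate : Type := Fin n ⊕ Fin ℓ ⊕ (Σ g : S.Wire, Option (S.form g).Pos) ⊕ Fin m

/-- The gate carrying the value of a wire. -/
def wireGate (g : S.Wire) : S.Gate := .inr (.inr (.inl ⟨g, none⟩))

/-- The gate of a position of the formula of a wire. -/
def posGate (g : S.Wire) (p : (S.form g).Pos) : S.Gate := .inr (.inr (.inl ⟨g, some p⟩))

theorem posGate_injective (g : S.Wire) : Function.Injective (S.posGate g) := fun p q h => by
  cases h
  rfl

/-- The gate carrying the value of a variable. -/
def src : Fin n ⊕ Fin ℓ ⊕ S.Wire → S.Gate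
  | .inl j => .inl j
  | .inr (.inl j) => .inr (.inl j)
  | .inr (.inr g) => S.wireGate g

theorem src_ne_posGate (v : Fin n ⊕ Fin ℓ ⊕ S.Wire) (g : S.Wire) (p : (S.form g).Pos) :
    S.src v ≠ S.posGate g p := by
  rcases v with j | j | h <;> rintro ⟨⟩

theorem src_ne_output (v : Fin n ⊕ Fin ℓ ⊕ S.Wire) (j : Fin m) :
    S.src v ≠ .inr (.inr (.inr j)) := by
  rcases v with j | j | h <;> rintro ⟨⟩

/-- The labels of the gates of the compiled circuit. -/
def label : S.Gate → GateLabel n ℓ m S.Gate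
  | .inl j => .input j
  | .inr (.inl j) => .aux j
  -- This extra copying gate takes over the fan-out of the wire. Gates inside the formula, in
  -- particular function gates, thus keep outdegree one.
  | .inr (.inr (.inl ⟨g, none⟩)) => .add {S.posGate g (S.form g).root}
  | .inr (.inr (.inl ⟨g, some p⟩)) => (S.form g).label S.src (S.posGate g) p
  | .inr (.inr (.inr j)) => .output j (S.wireGate (S.out j))

/-- A function on the gates which increases along the edges of the compiled circuit. -/
def rank (c D : ℕ) : S.Gate → ℕ
  | .inl _ => 0
  | .inr (.inl _) => 0
  -- Each level owns a block of `c + 3` ranks: positions have offsets `1` to `c + 1`, growing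
  -- towards the root, and the wire gate has offset `c + 2`. Memory gates at rank `0` lie below all
  -- of them.
  | .inr (.inr (.inl ⟨g, none⟩)) => S.lev g * (c + 3) + (c + 2)
  | .inr (.inr (.inl ⟨g, some p⟩)) => S.lev g * (c + 3) + 1 + (c - (S.form g).distRoot p)
  | .inr (.inr (.inr _)) => (D + 1) * (c + 3)

variable {S} {A : Set (ℝ → ℝ)} {W c D : ℕ} (hS : S.Ok A W c D)

include hS

theorem Ok.mem_preds_pos {g : S.Wire} {p : (S.form g).Pos} {x : S.Gate}
    (hx : x ∈ (S.label (S.posGate g p)).preds) :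
    (∃ q, x = S.posGate g q ∧ (S.form g).parent q = some p) ∨ ∃ v, S.Lower g v ∧ x = S.src v :=
  (hS.form g).of_mem_preds hx

theorem Ok.rank_lt {x y : S.Gate} (h : x ∈ (S.label y).preds) : S.rank c D x < S.rank c D y := by
  rcases y with j | j | ⟨g, - | p⟩ | j
  · cases h
  · cases h
  · obtain rfl := Finset.mem_singleton.1 h
    change S.lev g * (c + 3) + 1 + (c - _) < S.lev g * (c + 3) + (c + 2)
    omega
  · obtain ⟨q, rfl, hq⟩ | ⟨v, hv, rfl⟩ := hS.mem_preds_pos h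
    · have h1 := Formula.distRoot_of_parent hq
      have h2 := (hS.form g).distRoot_le q
      change S.lev g * (c + 3) + 1 + (c - (S.form g).distRoot q) <
        S.lev g * (c + 3) + 1 + (c - (S.form g).distRoot p)
      omega
    · rcases v with j | j | g'
      · change 0 < S.lev g * (c + 3) + 1 + (c - (S.form g).distRoot p)
        omega
      · change 0 < S.lev g * (c + 3) + 1 + (c - (S.form g).distRoot p)
        omega
      · change S.lev g' * (c + 3) + (c + 2) < S.lev g * (c + 3) + 1 + (c - (S.form g).distRoot p)
        have h1 : S.lev g' + 1 ≤ S.lev g := hv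
        have h2 := Nat.mul_le_mul_right (c + 3) h1
        rw [Nat.succ_mul] at h2
        omega
  · obtain rfl := Finset.mem_singleton.1 h
    change S.lev (S.out j) * (c + 3) + (c + 2) < (D + 1) * (c + 3)
    have h2 := Nat.mul_le_mul_right (c + 3) (hS.lev_le (S.out j))
    rw [Nat.succ_mul]
    omega

/-- The successor is the parent, or the wire gate in case of the root. Nothing else can refer to a
position, because variables are read only from memory gates and wire gates. -/
theorem Ok.existsUnique_succ (g : S.Wire) (q : (S.form g).Pos) :
    ∃! h, S.posGate g q ∈ (S.label h).preds := by
  have key : ∀ h, S.posGate g q ∈ (S.label h).preds →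
      (h = S.wireGate g ∧ q = (S.form g).root) ∨
        ∃ p, h = S.posGate g p ∧ (S.form g).parent q = some p := by
    intro h hh
    rcases h with j | j | ⟨g', - | p⟩ | j
    · cases hh
    · cases hh
    · cases Finset.mem_singleton.1 hh
      exact Or.inl ⟨rfl, rfl⟩
    · obtain ⟨q', h', hq⟩ | ⟨v, -, h'⟩ := hS.mem_preds_pos hh
      · cases h'
        exact Or.inr ⟨p, rfl, hq⟩
      · exact (S.src_ne_posGate v g q h'.symm).elim
    · exact (S.src_ne_posGate (.inr (.inr (S.out j))) g q (Finset.mem_singleton.1 hh).symm).elim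
  cases hq : (S.form g).parent q with
  | none =>
    obtain rfl := Formula.parent_eq_none hq
    refine ⟨S.wireGate g, Finset.mem_singleton_self _, fun h hh => ?_⟩
    obtain h' | ⟨p, -, hp⟩ := key h hh
    · exact h'.1
    · rw [hq] at hp
      cases hp
  | some p =>
    refine ⟨S.posGate g p, Formula.mem_preds_of_parent hq, fun h hh => ?_⟩
    obtain ⟨-, rfl⟩ | ⟨p', h', hp⟩ := key h hh
    · rw [Formula.parent_root] at hq
      cases hq
    · rw [hq] at hp
      cases hp
      exact h'

/-- The circuit evaluating a system of formulas. -/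
def Ok.toCircuit : ExtCircuit n ℓ m where
  Gate := S.Gate
  fintypeGate := inferInstance
  label := S.label
  acyclic := Subrelation.wf (fun h => hS.rank_lt h) (measure (S.rank c D)).wf
  inGate := .inl
  auxGate j := .inr (.inl j)
  outGate j := .inr (.inr (.inr j))
  label_input g j := by
    constructor
    · intro h
      rcases g with j | j | ⟨g', - | p⟩ | j
      · cases h
        rfl
      · cases h
      · cases h
      · exact ((Formula.label_ne _ _ _).1 _ h).elim
      · cases h
    · rintro rfl
      rfl
  label_aux g j := by
    constructor
    · intro h
      rcases g with j | j | ⟨g', - | p⟩ | j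
      · cases h
      · cases h
        rfl
      · cases h
      · exact ((Formula.label_ne _ _ _).2.1 _ h).elim
      · cases h
    · rintro rfl
      rfl
  label_output g j := by
    constructor
    · rintro ⟨x, h⟩
      rcases g with j | j | ⟨g', - | p⟩ | j
      · cases h
      · cases h
      · cases h
      · exact ((Formula.label_ne _ _ _).2.2 _ _ h).elim
      · cases h
        rfl
    · rintro rfl
      exact ⟨_, rfl⟩
  outGate_fanout j g h := by
    rcases g with j | j | ⟨g', - | p⟩ | j
    · cases h
    · cases h
    · cases Finset.mem_singleton.1 h
    · obtain ⟨q', h', hq⟩ | ⟨v, -, h'⟩ := hS.mem_preds_pos h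
      · cases h'
      · exact S.src_ne_output v _ h'.symm
    · cases Finset.mem_singleton.1 h
  func_fanout g f x h := by
    rcases g with j | j | ⟨g', - | p⟩ | j
    · cases h
    · cases h
    · cases h
    · exact hS.existsUnique_succ g' p
    · cases h

theorem Ok.usesOnly : hS.toCircuit.UsesOnly A := by
  rintro (j | j | ⟨g, - | p⟩ | j) f x h
  · cases h
  · cases h
  · cases h
  · exact (hS.form g).mem_of_label_eq_func h
  · cases h

theorem Ok.depth_le : hS.toCircuit.depth ≤ (D + 1) * (c + 3) := by
  refine Finset.sup_le fun x _ => (hS.toCircuit.level_le (fun _ _ h => hS.rank_lt h) x).trans ?_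
  rcases x with j | j | ⟨g, - | p⟩ | j
  · exact Nat.zero_le _
  · exact Nat.zero_le _
  · change S.lev g * (c + 3) + (c + 2) ≤ _
    have h2 := Nat.mul_le_mul_right (c + 3) (hS.lev_le g)
    rw [Nat.succ_mul]
    omega
  · change S.lev g * (c + 3) + 1 + (c - _) ≤ _
    have h2 := Nat.mul_le_mul_right (c + 3) (hS.lev_le g)
    rw [Nat.succ_mul]
    omega
  · exact le_rfl

theorem Ok.size_le :
    hS.toCircuit.size ≤ n + ℓ + m + Fintype.card S.Wire * ((W + 3) ^ c + 1) := by
  have h1 : hS.toCircuit.size = n + (ℓ + (∑ g, (Fintype.card (S.form g).Pos + 1) + m)) := by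
    change Fintype.card S.Gate = _
    simp
  have h2 : ∑ g, (Fintype.card (S.form g).Pos + 1) ≤
      Fintype.card S.Wire * ((W + 3) ^ c + 1) := by
    simpa only [Finset.card_univ, smul_eq_mul] using Finset.sum_le_card_nsmul Finset.univ
      (fun g => Fintype.card (S.form g).Pos + 1) _
      fun g _ => Nat.succ_le_succ (hS.form g).card_le
  omega

/-- A solution `w` of the system of formulas extends to all gates by the values of subformulas; by
`eq_val` this extension is the valuation of the circuit. -/
theorem Ok.val_toCircuit {x : Fin n → ℝ} {a : Fin ℓ → ℝ} {w : S.Wire → ℝ}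
    (hw : ∀ g, w g = (S.form g).eval (Sum.elim x (Sum.elim a w))) (g : S.Wire) :
    hS.toCircuit.val x a (S.wireGate g) = w g := by
  let u : S.Gate → ℝ
    | .inl j => x j
    | .inr (.inl j) => a j
    | .inr (.inr (.inl ⟨g, none⟩)) => w g
    | .inr (.inr (.inl ⟨g, some p⟩)) => (S.form g).value (Sum.elim x (Sum.elim a w)) p
    | .inr (.inr (.inr j)) => w (S.out j)
  have hsrc : ∀ v, u (S.src v) = Sum.elim x (Sum.elim a w) v := by
    rintro (j | j | g) <;> rfl
  have hu : u = hS.toCircuit.val x a := by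
    refine hS.toCircuit.eq_val ?_
    rintro (j | j | ⟨g, - | p⟩ | j)
    · rfl
    · rfl
    · refine Eq.trans ?_ (Finset.sum_singleton _ _).symm
      exact (hw g).trans (Formula.value_root _ _).symm
    · exact (Formula.apply_label (S.posGate_injective g) hsrc (fun _ => rfl) x a p).symm
    · rfl
  rw [← hu]
  rfl

theorem Ok.val_inGate (x : Fin n → ℝ) (a : Fin ℓ → ℝ) (j : Fin n) :
    hS.toCircuit.val x a (.inl j) = x j :=
  hS.toCircuit.val_eq x a _

theorem Ok.eval_toCircuit {x : Fin n → ℝ} {a : Fin ℓ → ℝ} {w : S.Wire → ℝ}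
    (hw : ∀ g, w g = (S.form g).eval (Sum.elim x (Sum.elim a w))) (j : Fin m) :
    hS.toCircuit.eval x a j = w (S.out j) := by
  rw [← hS.val_toCircuit hw]
  exact hS.toCircuit.val_eq x a _

end Netlist

/-! ### Formulas for the gates of a circuit -/

namespace GateLabel

variable {n ℓ m : ℕ} {γ V : Type}

/-- The formula of a gate of a circuit, where the memory gates are replaced by formulas and the
values of the gates are the variables given by `e`. -/
def toFormula (inF : Fin n → Formula V) (auxF : Fin ℓ → Formula V) (e : γ → V) :
    GateLabel n ℓ m γ → Formula V
  | input j => inF j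
  | aux j => auxF j
  | const c => .const c
  | add s => .sum fun i : s => .var (e i)
  | mul s => .prod fun i : s => .var (e i)
  | func f h => .func f (.var (e h))
  | output _ h => .var (e h)

theorem eval_toFormula (inF : Fin n → Formula V) (auxF : Fin ℓ → Formula V) (e : γ → V)
    (ρ : V → ℝ) (L : GateLabel n ℓ m γ) :
    (L.toFormula inF auxF e).eval ρ =
      L.apply (fun j => (inF j).eval ρ) (fun j => (auxF j).eval ρ) (ρ ∘ e) := by
  cases L with
  | add s => exact Finset.sum_coe_sort s (ρ ∘ e)
  | mul s => exact Finset.prod_coe_sort s (ρ ∘ e)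
  | _ => rfl

/-- A gate is one operation on variables, hence depth `1`: simulating a circuit gate by gate costs
only a constant factor in depth. -/
theorem ok_toFormula {A : Set (ℝ → ℝ)} {W : ℕ} {P : V → Prop} {inF : Fin n → Formula V}
    {auxF : Fin ℓ → Formula V} {e : γ → V} {L : GateLabel n ℓ m γ} (hin : ∀ j, (inF j).Ok A W P 1)
    (haux : ∀ j, (auxF j).Ok A W P 1) (hW : L.preds.card ≤ W + 2)
    (hP : ∀ g ∈ L.preds, P (e g)) (hA : ∀ f p, L = .func f p → f ∈ A) :
    (L.toFormula inF auxF e).Ok A W P 1 := by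
  cases L with
  | input j => exact hin j
  | aux j => exact haux j
  | const c => exact Formula.ok_const c
  | add s => exact Formula.ok_sum (by simpa [preds] using hW) fun i => Formula.ok_var (hP i i.2)
  | mul s => exact Formula.ok_prod (by simpa [preds] using hW) fun i => Formula.ok_var (hP i i.2)
  | func f h =>
    exact Formula.ok_func (hA f h rfl) (Formula.ok_var (hP h (Finset.mem_singleton_self h)))
  | output j h => exact Formula.ok_var (hP h (Finset.mem_singleton_self h))

end GateLabel

/-! ### Running recurrent circuits inside a recurrent circuit -/

/-- The registers controlling the simulation of a recurrent circuit: the number of the iteration,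
whether the simulation is running, whether it has halted, and the result. -/
inductive Flag : Type
  | cnt
  | run
  | done
  | res
  deriving DecidableEq

instance : Fintype Flag where
  elems := {.cnt, .run, .done, .res}
  complete f := by cases f <;> simp

/-- A finite family of recurrent circuits with circuits for their halting functions. -/
structure Bank where
  I : Type
  fintypeI : Fintype I
  arity : I → ℕ
  Q : ∀ i, RecCircuit (arity i)
  H : ∀ i, ExtCircuit ((Q i).numHalt + 1) 0 1
  H_eval : ∀ (i : I) (k : ℕ) (v : Fin (Q i).numHalt → ℝ), 1 ≤ k →
    (H i).eval (Fin.cons (k : ℝ) v) Fin.elim0 0 = if (Q i).halt k v then 1 else 0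

attribute [instance] Bank.fintypeI

/-- The first entry of a tuple, and zero if there is none. -/
def fstOrZero {k : ℕ} (y : Fin k → ℝ) : ℝ := if h : 0 < k then y ⟨0, h⟩ else 0

namespace Bank

/-- The registers for the simulation of the circuits of a family: copies of the memory gates, and
the control registers. -/
abbrev Reg (B : Bank) : Type := Σ i, Fin (B.arity i) ⊕ Fin (B.Q i).aux ⊕ Flag

variable {B : Bank}

/-- The copy of the `j`-th input gate of the `i`-th circuit. -/
def argReg (i : B.I) (j : Fin (B.arity i)) : B.Reg := ⟨i, .inl j⟩

/-- The copy of the `j`-th auxiliary memory gate of the `i`-th circuit. -/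
def auxReg (i : B.I) (j : Fin (B.Q i).aux) : B.Reg := ⟨i, .inr (.inl j)⟩

/-- The control registers of the `i`-th circuit. -/
def flagReg (i : B.I) (f : Flag) : B.Reg := ⟨i, .inr (.inr f)⟩

/-- The values of the gates of the `i`-th circuit. -/
def gateVal (s : B.Reg → ℝ) (i : B.I) : (B.Q i).C.Gate → ℝ :=
  (B.Q i).C.val (fun j => s (argReg i j)) fun j => s (auxReg i j)

/-- The values of the gates of the halting circuit of the `i`-th circuit. -/
def haltVal (s : B.Reg → ℝ) (i : B.I) : (B.H i).Gate → ℝ :=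
  (B.H i).val (Fin.cons (s (flagReg i .cnt)) fun j => gateVal s i ((B.Q i).haltGate j)) Fin.elim0

/-- The value of the first output gate of the `i`-th circuit. -/
def outVal (s : B.Reg → ℝ) (i : B.I) : ℝ :=
  fstOrZero fun j => gateVal s i ((B.Q i).C.outGate j)

end Bank

/-- Formulas controlling the simulation of a family of recurrent circuits by a recurrent circuit
with `N` inputs and `m` outputs: when each circuit is started, with which arguments, when the
simulation is finished, and with which outputs. -/
structure Control (B : Bank) (N m : ℕ) where
  start : B.I → Formula (Fin N ⊕ B.Reg)
  arg : ∀ i, Fin (B.arity i) → Formula (Fin N ⊕ B.Reg)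
  out : Fin m → Formula (Fin N ⊕ B.Reg)
  halt : Formula (Fin N ⊕ B.Reg)

namespace Control

open Bank

variable {B : Bank} {N m : ℕ} (K : Control B N m)

/-- The new values of the registers after one iteration. -/
def next (x : Fin N → ℝ) (s : B.Reg → ℝ) : B.Reg → ℝ
  -- While the copy is idle its memory is reloaded in every iteration, so when it begins to run it
  -- holds the arguments present at the starting signal.
  | ⟨i, .inl j⟩ => s (flagReg i .run) * gateVal s i ((B.Q i).recIn j) +
      (1 - s (flagReg i .run)) * (K.arg i j).eval (Sum.elim x s)
  | ⟨i, .inr (.inl j)⟩ => s (flagReg i .run) * gateVal s i ((B.Q i).recAux j) +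
      (1 - s (flagReg i .run)) * (B.Q i).init j
  -- Idling resets the counter to `1`, the number of the first simulated iteration.
  | ⟨i, .inr (.inr .cnt)⟩ => s (flagReg i .run) * s (flagReg i .cnt) + 1
  | ⟨i, .inr (.inr .run)⟩ => (K.start i).eval (Sum.elim x s)
  -- The flag latches: once `1` it stays `1`. The factor `run` suppresses the meaningless halting
  -- values of an idle copy.
  | ⟨i, .inr (.inr .done)⟩ => s (flagReg i .done) +
      (1 - s (flagReg i .done)) * (s (flagReg i .run) * haltVal s i ((B.H i).outGate 0))
  -- The result follows the current output until the flag is set and is frozen from then on,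
  -- although the copy itself keeps running.
  | ⟨i, .inr (.inr .res)⟩ => s (flagReg i .done) * s (flagReg i .res) +
      (1 - s (flagReg i .done)) * outVal s i

/-- The values of the registers at the beginning of iteration `t + 1`. -/
def mem (x : Fin N → ℝ) (t : ℕ) : B.Reg → ℝ := (K.next x)^[t] 0

theorem mem_succ (x : Fin N → ℝ) (t : ℕ) : K.mem x (t + 1) = K.next x (K.mem x t) :=
  Function.iterate_succ_apply' _ _ _

/-- The value of a formula in iteration `t + 1`. -/
def ev (x : Fin N → ℝ) (t : ℕ) (F : Formula (Fin N ⊕ B.Reg)) : ℝ :=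
  F.eval (Sum.elim x (K.mem x t))

/-! ### Dynamics of a single simulated circuit -/

section Behaviour

variable (x : Fin N → ℝ) (i : B.I)

theorem mem_run_succ (t : ℕ) :
    K.mem x (t + 1) (flagReg i .run) = K.ev x t (K.start i) := by
  rw [mem_succ]
  rfl

theorem mem_done_succ (t : ℕ) :
    K.mem x (t + 1) (flagReg i .done) = K.mem x t (flagReg i .done) +
      (1 - K.mem x t (flagReg i .done)) * (K.mem x t (flagReg i .run) *
        haltVal (K.mem x t) i ((B.H i).outGate 0)) := by
  rw [mem_succ]
  rfl

theorem mem_res_succ (t : ℕ) :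
    K.mem x (t + 1) (flagReg i .res) = K.mem x t (flagReg i .done) * K.mem x t (flagReg i .res) +
      (1 - K.mem x t (flagReg i .done)) * outVal (K.mem x t) i := by
  rw [mem_succ]
  rfl

theorem mem_cnt_succ (t : ℕ) :
    K.mem x (t + 1) (flagReg i .cnt) =
      K.mem x t (flagReg i .run) * K.mem x t (flagReg i .cnt) + 1 := by
  rw [mem_succ]
  rfl

theorem mem_arg_succ (t : ℕ) (j : Fin (B.arity i)) :
    K.mem x (t + 1) (argReg i j) =
      K.mem x t (flagReg i .run) * gateVal (K.mem x t) i ((B.Q i).recIn j) +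
      (1 - K.mem x t (flagReg i .run)) * K.ev x t (K.arg i j) := by
  rw [mem_succ]
  rfl

theorem mem_aux_succ (t : ℕ) (j : Fin (B.Q i).aux) :
    K.mem x (t + 1) (auxReg i j) =
      K.mem x t (flagReg i .run) * gateVal (K.mem x t) i ((B.Q i).recAux j) +
      (1 - K.mem x t (flagReg i .run)) * (B.Q i).init j := by
  rw [mem_succ]
  rfl

variable {x i}

/-- As long as a circuit is not started, it neither runs nor halts. -/
theorem mem_before {T : ℕ} (h0 : ∀ t < T, K.ev x t (K.start i) = 0) {t : ℕ} (ht : t ≤ T) :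
    K.mem x t (flagReg i .run) = 0 ∧ K.mem x t (flagReg i .done) = 0 := by
  induction t with
  | zero => exact ⟨rfl, rfl⟩
  | succ t ih =>
    obtain ⟨ih1, ih2⟩ := ih (by omega)
    refine ⟨(K.mem_run_succ x i t).trans (h0 t (by omega)), ?_⟩
    rw [mem_done_succ, ih1, ih2]
    simp

/-- A circuit which is not started does not halt. -/
theorem done_eq_zero_of_start (h0 : ∀ t, K.ev x t (K.start i) = 0) (t : ℕ) :
    K.mem x t (flagReg i .done) = 0 :=
  (K.mem_before (fun t _ => h0 t) le_rfl).2

/-- The signal `r` changes from `0` to `1` at time `T`. -/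
def FiresAt (r : ℕ → ℝ) (T : ℕ) : Prop := ∀ t, r t = if T ≤ t then 1 else 0

variable {T : ℕ} (hT : FiresAt (fun t => K.ev x t (K.start i)) T)

include hT

/-- After the start, the memory gates are simulated. -/
theorem mem_after (k : ℕ) :
    K.mem x (T + 1 + k) (flagReg i .run) = 1 ∧
    K.mem x (T + 1 + k) (flagReg i .cnt) = (k + 1 : ℕ) ∧
    (∀ j, K.mem x (T + 1 + k) (argReg i j) =
      ((B.Q i).state (fun j => K.ev x T (K.arg i j)) k).1 j) ∧
    ∀ j, K.mem x (T + 1 + k) (auxReg i j) =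
      ((B.Q i).state (fun j => K.ev x T (K.arg i j)) k).2 j := by
  have h1 : ∀ k, K.mem x (T + 1 + k) (flagReg i .run) = 1 := fun k => by
    rw [show T + 1 + k = (T + k) + 1 by omega, mem_run_succ]
    simpa using hT (T + k)
  induction k with
  | zero =>
    -- The signal reaches `run` one iteration late, so the update at time `T` is still a load; the
    -- simulation is in its initial state at time `T + 1`.
    have h0 : K.mem x T (flagReg i .run) = 0 :=
      (K.mem_before (fun t ht => by simpa [not_le.2 ht] using hT t) le_rfl).1
    refine ⟨h1 0, ?_, fun j => ?_, fun j => ?_⟩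
    · rw [Nat.add_zero, mem_cnt_succ, h0]
      simp
    · rw [Nat.add_zero, mem_arg_succ, h0]
      simp [RecCircuit.state]
    · rw [Nat.add_zero, mem_aux_succ, h0]
      simp [RecCircuit.state]
  | succ k ih =>
    obtain ⟨ih1, ih2, ih3, ih4⟩ := ih
    have hs : (B.Q i).state (fun j => K.ev x T (K.arg i j)) (k + 1) =
        (B.Q i).step ((B.Q i).state (fun j => K.ev x T (K.arg i j)) k) :=
      Function.iterate_succ_apply' _ _ _
    have hg : gateVal (K.mem x (T + 1 + k)) i =
        (B.Q i).C.val ((B.Q i).state (fun j => K.ev x T (K.arg i j)) k).1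
          ((B.Q i).state (fun j => K.ev x T (K.arg i j)) k).2 := by
      rw [gateVal, funext ih3, funext ih4]
    refine ⟨h1 (k + 1), ?_, fun j => ?_, fun j => ?_⟩
    · rw [← Nat.add_assoc, mem_cnt_succ, ih1, ih2]
      push_cast
      ring
    · rw [← Nat.add_assoc, mem_arg_succ, ih1, hg, hs]
      simp [RecCircuit.step]
    · rw [← Nat.add_assoc, mem_aux_succ, ih1, hg, hs]
      simp [RecCircuit.step]

theorem gateVal_after (k : ℕ) : gateVal (K.mem x (T + 1 + k)) i =
    (B.Q i).C.val ((B.Q i).state (fun j => K.ev x T (K.arg i j)) k).1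
      ((B.Q i).state (fun j => K.ev x T (K.arg i j)) k).2 := by
  obtain ⟨-, -, h3, h4⟩ := K.mem_after hT k
  rw [gateVal, funext h3, funext h4]

/-- The counter holds `k + 1`, a positive iteration number, which is exactly where the halting
circuit is guaranteed to be correct. -/
theorem haltVal_after (k : ℕ) : haltVal (K.mem x (T + 1 + k)) i ((B.H i).outGate 0) =
    if (B.Q i).haltsAt (fun j => K.ev x T (K.arg i j)) k then 1 else 0 := by
  rw [haltVal, (K.mem_after hT k).2.1, K.gateVal_after hT k]
  exact B.H_eval i (k + 1) _ (by omega)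

theorem done_succ_after (k : ℕ) : K.mem x (T + 1 + k + 1) (flagReg i .done) =
    K.mem x (T + 1 + k) (flagReg i .done) + (1 - K.mem x (T + 1 + k) (flagReg i .done)) *
      if (B.Q i).haltsAt (fun j => K.ev x T (K.arg i j)) k then 1 else 0 := by
  rw [mem_done_succ, K.haltVal_after hT, (K.mem_after hT k).1, one_mul]

theorem done_of_le {t : ℕ} (ht : t ≤ T + 1) : K.mem x t (flagReg i .done) = 0 := by
  have h : ∀ {t}, t ≤ T → _ := fun {t} => K.mem_before (x := x) (i := i) (T := T) (t := t)
    (fun t ht => by simpa [not_le.2 ht] using hT t)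
  rcases Nat.lt_or_ge T t with h1 | h1
  · obtain rfl : t = T + 1 := by omega
    rw [mem_done_succ, (h le_rfl).1, (h le_rfl).2]
    simp
  · exact (h h1).2

theorem done_eq_zero_after {k : ℕ}
    (h : ∀ k' < k, (B.Q i).haltsAt (fun j => K.ev x T (K.arg i j)) k' = false) :
    K.mem x (T + 1 + k) (flagReg i .done) = 0 := by
  induction k with
  | zero => exact K.done_of_le hT le_rfl
  | succ k ih =>
    rw [← Nat.add_assoc, K.done_succ_after hT, ih fun k' hk' => h k' (by omega), h k (by omega)]
    simp

/-- A circuit whose computation does not halt is never marked as halted. -/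
theorem done_eq_zero (h : ¬ ((B.Q i).eval fun j => K.ev x T (K.arg i j)).Dom) (t : ℕ) :
    K.mem x t (flagReg i .done) = 0 := by
  have h' : ∀ k, (B.Q i).haltsAt (fun j => K.ev x T (K.arg i j)) k = false := by
    intro k
    by_contra hk
    refine h ?_
    refine Nat.rfind_dom.2 ⟨k, ?_, fun _ => trivial⟩
    simpa using hk
  rcases Nat.lt_or_ge t (T + 1) with h1 | h1
  · exact K.done_of_le hT h1.le
  · obtain ⟨k, rfl⟩ := Nat.exists_eq_add_of_le h1
    exact K.done_eq_zero_after hT fun k' _ => h' k'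

/-- A circuit whose computation halts is marked as halted from some time on, and then its result
is available. -/
theorem exists_done {y : Fin (B.Q i).out → ℝ}
    (hy : y ∈ (B.Q i).eval fun j => K.ev x T (K.arg i j)) :
    ∃ T', FiresAt (fun t => K.mem x t (flagReg i .done)) T' ∧
      ∀ t, T' ≤ t → K.mem x t (flagReg i .res) = fstOrZero y := by
  obtain ⟨k, hk, rfl⟩ := (Part.mem_map_iff _).1 hy
  obtain ⟨hk1, hk2⟩ := Nat.mem_rfind.1 hk
  have hk1 : (B.Q i).haltsAt (fun j => K.ev x T (K.arg i j)) k = true := by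
    simpa using (Part.mem_some_iff.1 hk1).symm
  have hk2 : ∀ k' < k, (B.Q i).haltsAt (fun j => K.ev x T (K.arg i j)) k' = false := by
    intro k' hk'
    simpa using (Part.mem_some_iff.1 (hk2 hk')).symm
  have h0 : ∀ t ≤ T + 1 + k, K.mem x t (flagReg i .done) = 0 := by
    intro t ht
    rcases Nat.lt_or_ge t (T + 1) with h1 | h1
    · exact K.done_of_le hT h1.le
    · obtain ⟨k', rfl⟩ := Nat.exists_eq_add_of_le h1
      exact K.done_eq_zero_after hT fun l hl => hk2 l (by omega)
  have h1 : ∀ l, K.mem x (T + 1 + k + 1 + l) (flagReg i .done) = 1 ∧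
      K.mem x (T + 1 + k + 1 + l) (flagReg i .res) =
        fstOrZero ((B.Q i).C.eval ((B.Q i).state (fun j => K.ev x T (K.arg i j)) k).1
          ((B.Q i).state (fun j => K.ev x T (K.arg i j)) k).2) := by
    intro l
    induction l with
    | zero =>
      rw [Nat.add_zero, K.done_succ_after hT, mem_res_succ, h0 _ le_rfl, hk1, outVal,
        K.gateVal_after hT]
      simp only [zero_mul, zero_add, sub_zero, one_mul, if_true, true_and]
      rfl
    | succ l ih =>
      rw [← Nat.add_assoc, mem_done_succ, mem_res_succ, ih.1, ih.2]
      simp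
  -- Simulated iteration `k + 1` takes place at time `T + 1 + k`; flag and result are both recorded
  -- one step later.
  refine ⟨T + 1 + k + 1, fun t => ?_, fun t ht => ?_⟩
  · split_ifs with ht
    · obtain ⟨l, rfl⟩ := Nat.exists_eq_add_of_le ht
      exact (h1 l).1
    · exact h0 t (by omega)
  · obtain ⟨l, rfl⟩ := Nat.exists_eq_add_of_le ht
    exact (h1 l).2

end Behaviour

/-! ### The simulating circuit -/

/-- The wires of the simulating circuit: the gates of the simulated circuits and of their halting
circuits, the new values of the registers, the outputs, and the halting signal. -/
abbrev Wire (B : Bank) (m : ℕ) : Type :=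
  (Σ i, (B.Q i).C.Gate ⊕ (B.H i).Gate) ⊕ B.Reg ⊕ Fin m ⊕ Unit

/-- The variables of the formulas of the simulating circuit. -/
abbrev Var (B : Bank) (N m : ℕ) : Type := Fin N ⊕ Fin (Fintype.card B.Reg) ⊕ Wire B m

/-- The memory gates as variables. -/
def memVar : Fin N ⊕ B.Reg → Var B N m
  | .inl j => .inl j
  | .inr r => .inr (.inl (Fintype.equivFin B.Reg r))

/-- The gates of the simulated circuits as variables. -/
def gateVar (i : B.I) (g : (B.Q i).C.Gate) : Var B N m := .inr (.inr (.inl ⟨i, .inl g⟩))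

/-- The gates of the halting circuits as variables. -/
def haltVar (i : B.I) (g : (B.H i).Gate) : Var B N m := .inr (.inr (.inl ⟨i, .inr g⟩))

/-- The formula for a register. -/
def reg (r : B.Reg) : Formula (Var B N m) := .var (memVar (.inr r))

/-- The formula for the first output of a simulated circuit. -/
def outForm (i : B.I) : Formula (Var B N m) :=
  if h : 0 < (B.Q i).out then .var (gateVar i ((B.Q i).C.outGate ⟨0, h⟩)) else .const 0

/-- The formulas of the simulating circuit. -/
def form : Wire B m → Formula (Var B N m)
  | .inl ⟨i, .inl g⟩ => ((B.Q i).C.label g).toFormula (fun j => reg (argReg i j))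
      (fun j => reg (auxReg i j)) (gateVar i)
  | .inl ⟨i, .inr g⟩ => ((B.H i).label g).toFormula
      (Fin.cons (reg (flagReg i .cnt)) fun j => .var (gateVar i ((B.Q i).haltGate j)))
      Fin.elim0 (haltVar i)
  | .inr (.inl ⟨i, .inl j⟩) =>
      reg (flagReg i .run) * .var (gateVar i ((B.Q i).recIn j)) +
      (.const 1 - reg (flagReg i .run)) * (K.arg i j).rename memVar
  | .inr (.inl ⟨i, .inr (.inl j)⟩) =>
      reg (flagReg i .run) * .var (gateVar i ((B.Q i).recAux j)) +
      (.const 1 - reg (flagReg i .run)) * .const ((B.Q i).init j)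
  | .inr (.inl ⟨i, .inr (.inr .cnt)⟩) => reg (flagReg i .run) * reg (flagReg i .cnt) + .const 1
  | .inr (.inl ⟨i, .inr (.inr .run)⟩) => (K.start i).rename memVar
  | .inr (.inl ⟨i, .inr (.inr .done)⟩) => reg (flagReg i .done) +
      (.const 1 - reg (flagReg i .done)) *
        (reg (flagReg i .run) * .var (haltVar i ((B.H i).outGate 0)))
  | .inr (.inl ⟨i, .inr (.inr .res)⟩) => reg (flagReg i .done) * reg (flagReg i .res) +
      (.const 1 - reg (flagReg i .done)) * outForm i
  | .inr (.inr (.inl j)) => (K.out j).rename memVar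
  | .inr (.inr (.inr _)) => K.halt.rename memVar

/-- The levels of the wires, where `D` is a bound for the depth of the simulated circuits and
their halting circuits. -/
def lev (D : ℕ) : Wire B m → ℕ
  | .inl ⟨i, .inl g⟩ => (B.Q i).C.level g
  -- Halting circuits read gates of the simulated circuits, so they are stacked above them; register
  -- updates read both and lie on top.
  | .inl ⟨i, .inr g⟩ => D + 1 + (B.H i).level g
  | .inr _ => 2 * D + 2

/-- The system of formulas of the simulating circuit. -/
abbrev netlist (D : ℕ) : Netlist N (Fintype.card B.Reg) m where
  Wire := Wire B m
  fintypeWire := inferInstance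
  form := K.form
  lev := lev D
  out j := .inr (.inr (.inl j))

/-- The values of the wires. -/
def wireVal (x : Fin N → ℝ) (s : B.Reg → ℝ) : Wire B m → ℝ
  | .inl ⟨i, .inl g⟩ => gateVal s i g
  | .inl ⟨i, .inr g⟩ => haltVal s i g
  | .inr (.inl r) => K.next x s r
  | .inr (.inr (.inl j)) => (K.out j).eval (Sum.elim x s)
  | .inr (.inr (.inr _)) => K.halt.eval (Sum.elim x s)

/-- The intended values solve the formula system, so the compiled circuit performs one step of
`next` per iteration. -/
theorem wireVal_eq (x : Fin N → ℝ) (s : B.Reg → ℝ) (g : Wire B m) :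
    K.wireVal x s g = (K.form g).eval
      (Sum.elim x (Sum.elim (s ∘ (Fintype.equivFin B.Reg).symm) (K.wireVal x s))) := by
  set ρ : Var B N m → ℝ :=
    Sum.elim x (Sum.elim (s ∘ (Fintype.equivFin B.Reg).symm) (K.wireVal x s)) with hρ
  have hmem : ρ ∘ memVar = Sum.elim x s := by
    funext v
    rcases v with j | r
    · rfl
    · simp [hρ, memVar]
  have hreg : ∀ r, (reg r : Formula (Var B N m)).eval ρ = s r := fun r =>
    congrFun hmem (.inr r)
  have hout : ∀ i, (outForm i : Formula (Var B N m)).eval ρ = outVal s i := by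
    intro i
    rw [outForm, outVal, fstOrZero]
    split_ifs <;> rfl
  rcases g with ⟨i, g | g⟩ | ⟨i, j | j | f⟩ | j | -
  · refine Eq.trans ?_ (GateLabel.eval_toFormula _ _ _ _ _).symm
    simp only [hreg]
    exact (B.Q i).C.val_eq _ _ g
  · refine Eq.trans ?_ (GateLabel.eval_toFormula _ _ _ _ _).symm
    have h1 : (fun j => ((Fin.cons (reg (flagReg i .cnt)) fun j =>
        .var (gateVar i ((B.Q i).haltGate j)) : Fin ((B.Q i).numHalt + 1) →
          Formula (Var B N m)) j).eval ρ) =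
        Fin.cons (s (flagReg i .cnt)) fun j => gateVal s i ((B.Q i).haltGate j) := by
      funext j
      refine Fin.cases ?_ (fun j => ?_) j
      · exact hreg _
      · rfl
    rw [h1, Subsingleton.elim (fun j => ((Fin.elim0 j : Formula (Var B N m)).eval ρ)) Fin.elim0]
    exact (B.H i).val_eq _ _ g
  · simp only [form, wireVal, next, Formula.eval_add, Formula.eval_mul, Formula.eval_sub, hreg,
      Formula.eval_const, Formula.eval_rename, hmem]
    rfl
  · simp only [form, wireVal, next, Formula.eval_add, Formula.eval_mul, Formula.eval_sub, hreg,
      Formula.eval_const]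
    rfl
  · cases f <;> simp only [form, wireVal, next, Formula.eval_add, Formula.eval_mul,
      Formula.eval_sub, hreg, Formula.eval_const, Formula.eval_rename, hmem, hout]
    rfl
  · simp only [form, wireVal, Formula.eval_rename, hmem]
  · simp only [form, wireVal, Formula.eval_rename, hmem]

/-- The formulas of the control use only functions in `A`, have fan-in at most `W + 2` and depth at
most `c`. -/
structure Ok (A : Set (ℝ → ℝ)) (W c : ℕ) : Prop where
  start : ∀ i, (K.start i).Ok A W (fun _ => True) c
  arg : ∀ i j, (K.arg i j).Ok A W (fun _ => True) c
  out : ∀ j, (K.out j).Ok A W (fun _ => True) c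
  halt : K.halt.Ok A W (fun _ => True) c

end Control

/-- The circuits of the family and their halting circuits use only functions in `A`, and have size
at most `W` and depth at most `D`. -/
structure Bank.Ok (B : Bank) (A : Set (ℝ → ℝ)) (W D : ℕ) : Prop where
  usesOnly : ∀ i, (B.Q i).C.UsesOnly A
  usesOnly_halt : ∀ i, (B.H i).UsesOnly A
  size : ∀ i, (B.Q i).C.size ≤ W
  size_halt : ∀ i, (B.H i).size ≤ W
  depth : ∀ i, (B.Q i).C.depth ≤ D
  depth_halt : ∀ i, (B.H i).depth ≤ D

namespace Control

open Bank Formula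

variable {B : Bank} {N m : ℕ} {K : Control B N m} {A : Set (ℝ → ℝ)} {W c D : ℕ}

/-- The extra `4` comes from the update `run * _ + (1 - run) * _` of a register: two levels for the
difference, one for the product, one for the sum. -/
theorem Ok.netlist (hB : B.Ok A W D) (hK : K.Ok A W c) :
    (K.netlist D).Ok A W (c + 4) (2 * D + 2) := by
  have hgl : ∀ i (g : (B.Q i).C.Gate), (B.Q i).C.level g ≤ D := fun i g =>
    ((B.Q i).C.level_le_depth g).trans (hB.depth i)
  have hhl : ∀ i (g : (B.H i).Gate), (B.H i).level g ≤ D := fun i g =>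
    ((B.H i).level_le_depth g).trans (hB.depth_halt i)
  refine ⟨fun g => ?_, fun g => ?_⟩
  swap
  · rcases g with ⟨i, g | g⟩ | g
    · exact (hgl i g).trans (by omega)
    · have := hhl i g
      change D + 1 + (B.H i).level g ≤ 2 * D + 2
      omega
    · exact le_rfl
  have hreg : ∀ (g : Wire B m) (r : B.Reg) (c : ℕ),
      (reg r : Formula (Var B N m)).Ok A W ((K.netlist D).Lower g) c := fun g r c =>
    ok_var trivial
  have hren : ∀ (g : Wire B m) (F : Formula (Fin N ⊕ B.Reg)), F.Ok A W (fun _ => True) c →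
      (F.rename memVar : Formula (Var B N m)).Ok A W ((K.netlist D).Lower g) c := fun g F hF =>
    hF.rename (by rintro (j | r) - <;> trivial)
  have hgv : ∀ (r : B.Reg ⊕ Fin m ⊕ Unit) (i : B.I) (g : (B.Q i).C.Gate) (c : ℕ),
      (.var (gateVar i g) : Formula (Var B N m)).Ok A W ((K.netlist D).Lower (.inr r)) c :=
    fun r i g c => ok_var (by
      have := hgl i g
      change (B.Q i).C.level g < 2 * D + 2
      omega)
  have hhv : ∀ (r : B.Reg ⊕ Fin m ⊕ Unit) (i : B.I) (g : (B.H i).Gate) (c : ℕ),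
      (.var (haltVar i g) : Formula (Var B N m)).Ok A W ((K.netlist D).Lower (.inr r)) c :=
    fun r i g c => ok_var (by
      have := hhl i g
      change D + 1 + (B.H i).level g < 2 * D + 2
      omega)
  have hout : ∀ (r : B.Reg ⊕ Fin m ⊕ Unit) (i : B.I) (c : ℕ),
      (outForm i : Formula (Var B N m)).Ok A W ((K.netlist D).Lower (.inr r)) c := by
    intro r i c
    rw [outForm]
    split_ifs
    · exact hgv _ _ _ _
    · exact ok_const _
  rcases g with ⟨i, g | g⟩ | ⟨i, j | j | f⟩ | j | -
  · refine Formula.Ok.deepen (GateLabel.ok_toFormula (fun j => hreg _ _ _) (fun j => hreg _ _ _)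
      ?_ ?_ fun f p h => hB.usesOnly i g f p h) (Nat.le_add_left 1 (c + 3))
    · exact ((Finset.card_le_univ _).trans (hB.size i)).trans (by omega)
    · exact fun h hh => (B.Q i).C.level_lt hh
  · refine Formula.Ok.deepen (GateLabel.ok_toFormula (fun j => ?_) (fun j => j.elim0)
      ?_ ?_ fun f p h => hB.usesOnly_halt i g f p h) (Nat.le_add_left 1 (c + 3))
    · refine Fin.cases ?_ (fun j => ?_) j
      · exact hreg _ _ _
      · refine ok_var ?_
        have h := hgl i ((B.Q i).haltGate j)
        exact (Nat.lt_succ_of_le h).trans_le (Nat.le_add_right _ _)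
    · exact ((Finset.card_le_univ _).trans (hB.size_halt i)).trans (by omega)
    · exact fun h hh => Nat.add_lt_add_left ((B.H i).level_lt hh) (D + 1)
  · exact (((hreg _ _ _).mul (hgv _ _ _ _)).add ((Formula.Ok.sub (ok_const 1) (hreg _ _ c)).mul
      ((hren _ _ (hK.arg i j)).deepen (by omega))))
  · exact (((hreg _ _ _).mul (hgv _ _ _ _)).add ((Formula.Ok.sub (ok_const 1) (hreg _ _ c)).mul
      (ok_const _)))
  · cases f
    · exact ((hreg _ _ (c + 2)).mul (hreg _ _ _)).add (ok_const 1)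
    · exact (hren _ _ (hK.start i)).deepen (by omega)
    · exact (hreg _ _ _).add ((Formula.Ok.sub (ok_const 1) (hreg _ _ c)).mul
        ((hreg _ _ _).mul (hhv _ _ _ _)))
    · exact ((hreg _ _ _).mul (hreg _ _ _)).add ((Formula.Ok.sub (ok_const 1) (hreg _ _ c)).mul
        (hout _ _ _))
  · exact (hren _ _ (hK.out j)).deepen (by omega)
  · exact (hren _ _ hK.halt).deepen (by omega)

/-- The recurrent circuit simulating a family of recurrent circuits. -/
abbrev toRec (hB : B.Ok A W D) (hK : K.Ok A W c) : RecCircuit N where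
  aux := Fintype.card B.Reg
  out := m
  C := (hK.netlist hB).toCircuit
  init := 0
  -- Input gates feed themselves, so the encoded graph stays available in every iteration.
  recIn := .inl
  recAux j := (K.netlist D).wireGate (.inr (.inl ((Fintype.equivFin B.Reg).symm j)))
  recIn_ne j k h := by cases h
  recAux_ne j k h := by cases h
  numHalt := 1
  haltGate := ⟨fun _ => (K.netlist D).wireGate (.inr (.inr (.inr ()))),
    Function.injective_of_subsingleton _⟩
  halt _ v := decide (0 < v 0)

theorem state_toRec (hB : B.Ok A W D) (hK : K.Ok A W c) (x : Fin N → ℝ) (t : ℕ) :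
    (toRec hB hK).state x t = (x, K.mem x t ∘ (Fintype.equivFin B.Reg).symm) := by
  induction t with
  | zero => rfl
  | succ t ih =>
    have h : (toRec hB hK).state x (t + 1) = (toRec hB hK).step ((toRec hB hK).state x t) :=
      Function.iterate_succ_apply' _ _ _
    rw [h, ih, mem_succ]
    refine Prod.ext (funext fun j => ?_) (funext fun j => ?_)
    · exact (hK.netlist hB).val_inGate _ _ j
    · exact (hK.netlist hB).val_toCircuit (K.wireVal_eq x (K.mem x t)) _

theorem haltsAt_toRec (hB : B.Ok A W D) (hK : K.Ok A W c) (x : Fin N → ℝ) (t : ℕ) :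
    (toRec hB hK).haltsAt x t = decide (0 < K.ev x t K.halt) := by
  rw [RecCircuit.haltsAt, state_toRec]
  have h := (hK.netlist hB).val_toCircuit (K.wireVal_eq x (K.mem x t)) (.inr (.inr (.inr ())))
  exact congrArg (fun r : ℝ => decide (0 < r)) h

/-- The simulating circuit computes the output in the first iteration with halting signal. -/
theorem eval_toRec_of_firesAt (hB : B.Ok A W D) (hK : K.Ok A W c) {x : Fin N → ℝ} {T : ℕ}
    (hT : FiresAt (fun t => K.ev x t K.halt) T) :
    (toRec hB hK).eval x = Part.some fun j => K.ev x T (K.out j) := by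
  have hev : (toRec hB hK).C.eval ((toRec hB hK).state x T).1 ((toRec hB hK).state x T).2 =
      fun j => K.ev x T (K.out j) := by
    rw [state_toRec]
    exact funext fun j => (hK.netlist hB).eval_toCircuit (K.wireVal_eq x (K.mem x T)) j
  rw [Part.eq_some_iff, RecCircuit.eval, Part.mem_map_iff]
  refine ⟨T, Nat.mem_rfind.2 ⟨?_, fun {t} ht => ?_⟩, hev⟩
  · have h : K.ev x T K.halt = 1 := by simpa using hT T
    simp [haltsAt_toRec, h]
  · have h : K.ev x t K.halt = 0 := by simpa [not_le.2 ht] using hT t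
    simp [haltsAt_toRec, h]

theorem eval_toRec_of_forall (hB : B.Ok A W D) (hK : K.Ok A W c) {x : Fin N → ℝ}
    (h : ∀ t, K.ev x t K.halt = 0) : (toRec hB hK).eval x = Part.none := by
  rw [Part.eq_none_iff']
  intro hd
  obtain ⟨t, ht, -⟩ := Nat.rfind_dom.1 hd
  simp [haltsAt_toRec, h] at ht

theorem depth_toRec_le (hB : B.Ok A W D) (hK : K.Ok A W c) :
    (toRec hB hK).C.depth ≤ (2 * D + 3) * (c + 7) := (hK.netlist hB).depth_le

theorem usesOnly_toRec (hB : B.Ok A W D) (hK : K.Ok A W c) : (toRec hB hK).C.UsesOnly A :=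
  (hK.netlist hB).usesOnly

theorem size_toRec_le (hB : B.Ok A W D) (hK : K.Ok A W c) (har : ∀ i, B.arity i ≤ W) :
    (toRec hB hK).C.size ≤ N + Fintype.card B.I * (2 * W + 4) + m +
      (Fintype.card B.I * (4 * W + 4) + m + 1) * ((W + 3) ^ (c + 4) + 1) := by
  -- Per copy: at most `W` argument registers, at most `W` auxiliary registers, and four flags.
  have hreg : Fintype.card B.Reg ≤ Fintype.card B.I * (2 * W + 4) := by
    rw [Fintype.card_sigma]
    refine (Finset.sum_le_card_nsmul Finset.univ _ (2 * W + 4) fun i _ => ?_).trans_eq (by simp)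
    have h1 := ((B.Q i).C.aux_le_size).trans (hB.size i)
    have h2 := har i
    have h3 : Fintype.card Flag = 4 := rfl
    simp only [Fintype.card_sum, Fintype.card_fin, h3]
    omega
  have hgate : Fintype.card (Σ i, (B.Q i).C.Gate ⊕ (B.H i).Gate) ≤
      Fintype.card B.I * (2 * W) := by
    rw [Fintype.card_sigma]
    refine (Finset.sum_le_card_nsmul Finset.univ _ (2 * W) fun i _ => ?_).trans_eq (by simp)
    have h1 : Fintype.card (B.Q i).C.Gate ≤ W := hB.size i
    have h2 : Fintype.card (B.H i).Gate ≤ W := hB.size_halt i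
    rw [Fintype.card_sum]
    omega
  have hwire : Fintype.card (Wire B m) ≤ Fintype.card B.I * (4 * W + 4) + m + 1 := by
    simp only [Fintype.card_sum, Fintype.card_fin, Fintype.card_unit]
    have : Fintype.card B.I * (4 * W + 4) =
        Fintype.card B.I * (2 * W + 4) + Fintype.card B.I * (2 * W) := by ring
    omega
  have h := (hK.netlist hB).size_le
  have h' := Nat.mul_le_mul_right ((W + 3) ^ (c + 4) + 1) hwire
  change (hK.netlist hB).toCircuit.size ≤ _
  change _ ≤ N + Fintype.card B.Reg + m + Fintype.card (Wire B m) * _ at h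
  omega

end Control

/-! ### Networks on directed graphs -/

open Classical in
/-- The successors of `v` with respect to a relation, in order. -/
def relNbrs {n : ℕ} (r : Fin n → Fin n → Prop) (v : Fin n) : List (Fin n) :=
  (List.finRange n).filter fun w => r v w

theorem length_relNbrs_lt {n : ℕ} (r : Fin n → Fin n → Prop) (v : Fin n) :
    (relNbrs r v).length < n + 1 :=
  Nat.lt_succ_of_le ((List.length_filter_le _ _).trans_eq List.length_finRange)

open Classical in
theorem sum_map_filter {α : Type} (p : α → Prop) (F : α → ℝ) (l : List α) :
    ((l.filter fun w => p w).map F).sum = (l.map fun w => if p w then F w else 0).sum := by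
  induction l with
  | nil => rfl
  | cons a l ih => by_cases h : p a <;> simp [h, ih]

-- A circuit has a fixed shape, so a sum over neighbours must be a masked sum over all vertices;
-- this translates between the two.
open Classical in
theorem sum_relNbrs {n : ℕ} (r : Fin n → Fin n → Prop) (v : Fin n) (F : Fin n → ℝ) :
    ∑ w, (if r v w then F w else 0) = ∑ i, F ((relNbrs r v).get i) := by
  rw [Fin.sum_univ_def, ← sum_map_filter, ← relNbrs, ← List.sum_ofFn]
  congr 1
  rw [← Function.comp_def, ← List.map_ofFn, List.ofFn_get]

theorem strictMono_get_relNbrs {n : ℕ} (r : Fin n → Fin n → Prop) (v : Fin n) :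
    StrictMono (relNbrs r v).get := by
  have h : (relNbrs r v).Pairwise (· < ·) := (List.pairwise_lt_finRange n).filter _
  exact fun i j hij => List.pairwise_iff_get.1 h i j hij

-- The list is increasing, so a neighbour's index is the number of smaller neighbours. This lets a
-- formula locate the `j`-th neighbour by counting.
open Classical in
theorem sum_lt_get_relNbrs {n : ℕ} (r : Fin n → Fin n → Prop) (v : Fin n)
    (i : Fin (relNbrs r v).length) :
    ∑ w, (if r v w then if w < (relNbrs r v).get i then (1 : ℝ) else 0 else 0) = (i : ℕ) := by
  rw [sum_relNbrs r v fun w => if w < (relNbrs r v).get i then (1 : ℝ) else 0]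
  simp only [(strictMono_get_relNbrs r v).lt_iff_lt]
  rw [Finset.sum_boole, show (Finset.univ.filter fun a => a < i) = Finset.Iio i by ext; simp,
    Fin.card_Iio]

namespace RecCGNN

variable (N : RecCGNN) {n : ℕ}

/-- One layer of the network on a directed graph. -/
def relStep (r : Fin n → Fin n → Prop) (i : ℕ) (h : Fin n → ℝ) : Part (Fin n → ℝ) where
  Dom := ∀ v, (N.layer i (h v :: (relNbrs r v).map h)).Dom
  get := fun hd v => N.act i ((N.layer i (h v :: (relNbrs r v).map h)).get (hd v))

/-- The feature values of a directed graph after `i` layers. -/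
def relFeats (r : Fin n → Fin n → Prop) (h : Fin n → ℝ) : ℕ → Part (Fin n → ℝ)
  | 0 => Part.some h
  | i + 1 => (relFeats r h i).bind (N.relStep r (i + 1))

theorem feats_eq (G : LGraph) (i : ℕ) : N.feats G i = N.relFeats G.graph.Adj G.feat i := by
  induction i with
  | zero => rfl
  | succ i ih => exact congrArg (fun p => Part.bind p (N.layerStep G (i + 1))) ih

theorem relFeats_dom {r : Fin n → Fin n → Prop} (h : ∀ i g, (N.relStep r i g).Dom)
    (h0 : Fin n → ℝ) (i : ℕ) : (N.relFeats r h0 i).Dom := by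
  induction i with
  | zero => trivial
  | succ i ih => exact ⟨ih, h _ _⟩

theorem relFeats_dom_of_le {r : Fin n → Fin n → Prop} {h0 : Fin n → ℝ} {i j : ℕ} (hij : i ≤ j)
    (h : (N.relFeats r h0 j).Dom) : (N.relFeats r h0 i).Dom := by
  induction hij with
  | refl => exact h
  | step _ ih => exact ih h.1

/-- A network halting at the fixed layer `d` computes the features after `d` layers. -/
theorem eval_eq {d : ℕ} (hd : 1 ≤ d) (hN : ∀ i l, N.halt i l = decide (i = d)) (G : LGraph) :
    N.eval G = (N.relFeats G.graph.Adj G.feat d).map fun h => { G with feat := h } := by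
  obtain ⟨e, rfl⟩ := Nat.exists_eq_add_of_le' hd
  have hdom : ∀ k ≤ e, (N.relFeats G.graph.Adj G.feat (e + 1)).Dom → (N.feats G (k + 1)).Dom :=
    fun k hk h => by
      rw [feats_eq]
      exact N.relFeats_dom_of_le (by omega) h
  refine Part.ext fun H => ?_
  rw [RecCGNN.eval, Part.mem_bind_iff, Part.mem_map_iff]
  constructor
  · rintro ⟨k, hk, hH⟩
    obtain ⟨h, -, hk⟩ := (Part.mem_map_iff _).1 (Nat.mem_rfind.1 hk).1
    obtain rfl : k = e := by simpa [hN] using hk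
    rw [feats_eq] at hH
    exact (Part.mem_map_iff _).1 hH
  · rintro ⟨h, hh, rfl⟩
    have hh' : h ∈ N.feats G (e + 1) := by rwa [feats_eq]
    refine ⟨e, Nat.mem_rfind.2 ⟨(Part.mem_map_iff _).2 ⟨h, hh', by simp [hN]⟩, fun {k} hk => ?_⟩,
      Part.mem_map _ hh'⟩
    -- `Nat.rfind` requires the halting test to be defined at all earlier layers too, so definedness
    -- is passed down from the last layer.
    have h1 := hdom k hk.le (Part.dom_iff_mem.2 ⟨h, hh⟩)
    refine (Part.mem_map_iff _).2 ⟨_, Part.get_mem h1, ?_⟩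
    simpa [hN] using hk.ne

end RecCGNN

/-! ### The circuit simulating a network -/

/-- The length of `List.ofFn z` equals `n` only propositionally; generalising over the length avoids
transporting circuits along that equality. -/
theorem RecFamily.eval_ofFn (R : RecFamily) {n : ℕ} (z : Fin n → ℝ) :
    R.eval (List.ofFn z) = ((R n).eval z).map List.ofFn := by
  have key : ∀ (n' : ℕ) (h : n' = n) (z' : Fin n' → ℝ), (∀ i, z' i = z (Fin.cast h i)) →
      ((R n').eval z').map List.ofFn = ((R n).eval z).map List.ofFn := by
    rintro n' rfl z' hz
    obtain rfl : z' = z := funext hz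
    rfl
  exact key _ List.length_ofFn _ fun i => List.get_ofFn z i

/-- Recurrent circuit families with their halting circuits, and activation functions, for the `d`
layers of a network. -/
structure Layers (d : ℕ) where
  R : Fin d → RecFamily
  H : Fin d → ∀ k, ExtCircuit k 0 1
  H_eval : ∀ (k : Fin d) (n i : ℕ) (v : Fin (R k n).numHalt → ℝ), 1 ≤ i →
    (H k ((R k n).numHalt + 1)).eval (Fin.cons (i : ℝ) v) Fin.elim0 0 =
      if (R k n).halt i v then 1 else 0
  act : Fin d → ℝ → ℝ

namespace Layers

variable {d : ℕ} (L : Layers d) (n : ℕ)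

/-- For each layer and each vertex, the members of the layer's circuit family for all possible
degrees of the vertex. -/
abbrev bank : Bank where
  I := Fin d × Fin n × Fin (n + 1)
  fintypeI := inferInstance
  arity i := i.2.2 + 1
  Q i := L.R i.1 (i.2.2 + 1)
  H i := L.H i.1 _
  H_eval i := L.H_eval i.1 _

variable {n} {N : ℕ} (hN : n * n + n ≤ N)

/-- The position of an entry of the adjacency matrix in the encoding of a graph. -/
def adjIdx (v w : Fin n) : Fin N :=
  ⟨v * n + w, by
    have h := Nat.mul_le_mul_right n (Nat.succ_le_of_lt v.2)
    rw [Nat.succ_mul] at h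
    have := w.2
    omega⟩

/-- The position of a feature value in the encoding of a graph. -/
def featIdx (v : Fin n) : Fin N := ⟨n * n + v, by have := v.2; omega⟩

/-- The directed graph read off a tuple of real numbers. -/
def adjRel (x : Fin N → ℝ) (v w : Fin n) : Prop := 0 < x (adjIdx hN v w)

/-- The formula for an edge. -/
def edge (v w : Fin n) : Formula (Fin N ⊕ (L.bank n).Reg) :=
  .func sgn (.var (.inl (adjIdx hN v w)))

/-- A formula testing whether an integral value is `j`. -/
def isEq {V : Type} (F : Formula V) (j : ℕ) : Formula V :=
  -- The half-integer offsets keep integral values away from `0`, where `sgn` is not symmetric.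
  .func sgn (F - .const (j - 1 / 2)) * .func sgn (.const (j + 1 / 2) - F)

/-- A formula testing whether the degree of `v` is `j`. -/
def isDeg (v : Fin n) (j : ℕ) : Formula (Fin N ⊕ (L.bank n).Reg) :=
  isEq (.sum fun w => L.edge hN v w) j

/-- The value of a control register of the circuit which is in charge of `v`. -/
def select (k : Fin d) (f : Flag) (v : Fin n) : Formula (Fin N ⊕ (L.bank n).Reg) :=
  .sum fun δ : Fin (n + 1) =>
    L.isDeg hN v δ * .var (.inr (Bank.flagReg (B := L.bank n) (k, v, δ) f))

/-- The formula for the feature value of `v` after `k` layers. -/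
def feat (k : Fin (d + 1)) (v : Fin n) : Formula (Fin N ⊕ (L.bank n).Reg) :=
  -- Registers hold values before activation; the activation is applied on reading. Only registers
  -- are read, so the depth does not grow with `k`.
  Fin.cases (.var (.inl (featIdx hN v))) (fun k => .func (L.act k) (L.select hN k .res v)) k

/-- The formula for the signal that the feature values after `k` layers are available. -/
def ready (k : Fin (d + 1)) : Formula (Fin N ⊕ (L.bank n).Reg) :=
  Fin.cases (.const 1) (fun k => .prod fun v => L.select hN k .done v) k

/-- The formula for the feature value of the `j`-th neighbour of `v` after `k` layers. -/
def nbrFeat (k : Fin (d + 1)) (v : Fin n) (j : ℕ) : Formula (Fin N ⊕ (L.bank n).Reg) :=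
  -- The summand of `w` survives exactly if `w` is a neighbour of `v` with `j` neighbours of `v`
  -- before it.
  .sum fun w => L.edge hN v w *
    isEq (.sum fun w' => if w' < w then L.edge hN v w' else .const 0) j * L.feat hN k w

/-- The formulas controlling the simulation of the network. -/
def control : Control (L.bank n) N (n * n + n) where
  start i := L.ready hN i.1.castSucc
  arg i := Fin.cons (L.feat hN i.1.castSucc i.2.1) fun j => L.nbrFeat hN i.1.castSucc i.2.1 j
  out := Fin.append (fun a => .var (.inl (Fin.castLE ((Nat.le_add_right _ _).trans hN) a)))
    fun v => L.feat hN (Fin.last d) v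
  halt := L.ready hN (Fin.last d)

/-! ### Values of the control formulas -/

section Eval

variable (x : Fin N → ℝ) (s : (L.bank n).Reg → ℝ)

open Classical in
theorem eval_edge (v w : Fin n) :
    (L.edge hN v w).eval (Sum.elim x s) = if adjRel hN x v w then 1 else 0 := rfl

theorem eval_isEq {V : Type} {ρ : V → ℝ} {F : Formula V} {a : ℕ} (h : F.eval ρ = a) (j : ℕ) :
    (isEq F j).eval ρ = if a = j then 1 else 0 := by
  simp only [isEq, Formula.eval_mul, Formula.eval_func, Formula.eval_sub, Formula.eval_const, h,
    sgn, sub_pos]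
  rcases lt_trichotomy a j with h | h | h
  · have : (a : ℝ) + 1 ≤ j := by exact_mod_cast h
    rw [if_neg (by linarith : ¬ (j : ℝ) - 1 / 2 < a), if_neg h.ne, zero_mul]
  · subst h
    rw [if_pos (by linarith), if_pos (by linarith), if_pos rfl, one_mul]
  · have : (j : ℝ) + 1 ≤ a := by exact_mod_cast h
    rw [if_neg (by linarith : ¬ (a : ℝ) < j + 1 / 2), if_neg h.ne', mul_zero]

theorem eval_isDeg (v : Fin n) (j : ℕ) : (L.isDeg hN v j).eval (Sum.elim x s) =
    if (relNbrs (adjRel hN x) v).length = j then 1 else 0 := by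
  classical
  refine eval_isEq ?_ j
  simp only [Formula.eval_sum, eval_edge]
  rw [sum_relNbrs _ v fun _ => 1]
  simp

/-- The degree of a vertex. -/
def deg (v : Fin n) : Fin (n + 1) := ⟨_, length_relNbrs_lt (adjRel hN x) v⟩

/-- Copies for wrong degrees may run forever or hold meaningless results; the degree test multiplies
their registers by `0`. -/
theorem eval_select (k : Fin d) (f : Flag) (v : Fin n) :
    (L.select hN k f v).eval (Sum.elim x s) =
      s (Bank.flagReg (B := L.bank n) (k, v, deg hN x v) f) := by
  simp only [select, Formula.eval_sum, Formula.eval_mul, eval_isDeg, Formula.eval_var]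
  rw [Finset.sum_eq_single (deg hN x v)]
  · simp [deg]
  · intro δ _ hδ
    rw [if_neg, zero_mul]
    exact fun h => hδ (Fin.ext h.symm)
  · simp

theorem eval_nbrFeat (k : Fin (d + 1)) (v : Fin n)
    (j : Fin (relNbrs (adjRel hN x) v).length) :
    (L.nbrFeat hN k v j).eval (Sum.elim x s) =
      (L.feat hN k ((relNbrs (adjRel hN x) v).get j)).eval (Sum.elim x s) := by
  classical
  have h : ∀ i : Fin (relNbrs (adjRel hN x) v).length,
      (isEq (.sum fun w' => if w' < (relNbrs (adjRel hN x) v).get i then L.edge hN v w' else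
        .const 0) j).eval (Sum.elim x s) = if (i : ℕ) = j then 1 else 0 := by
    intro i
    refine eval_isEq ?_ j
    rw [← sum_lt_get_relNbrs, Formula.eval_sum]
    refine Finset.sum_congr rfl fun w _ => ?_
    split_ifs with h1 h2 h2
    · simp [eval_edge, h2]
    · simp [eval_edge, h2]
    · rfl
    · rfl
  simp only [nbrFeat, Formula.eval_sum, Formula.eval_mul, eval_edge, ite_mul, one_mul, zero_mul]
  rw [sum_relNbrs _ v fun w => (isEq (.sum fun w' => if w' < w then L.edge hN v w' else
    .const 0) j).eval (Sum.elim x s) * (L.feat hN k w).eval (Sum.elim x s)]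
  simp only [h]
  rw [Finset.sum_eq_single j]
  · simp
  · intro i _ hi
    rw [if_neg fun h => hi (Fin.ext h), zero_mul]
  · simp

/-- The arguments of the circuit which is in charge of `v`. -/
theorem ofFn_eval_arg (k : Fin d) (v : Fin n) :
    List.ofFn (fun j => ((L.control hN).arg (k, v, deg hN x v) j).eval (Sum.elim x s)) =
      (L.feat hN k.castSucc v).eval (Sum.elim x s) ::
        (relNbrs (adjRel hN x) v).map fun w => (L.feat hN k.castSucc w).eval (Sum.elim x s) := by
  refine (List.ofFn_succ ..).trans (congrArg₂ List.cons rfl ?_)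
  refine List.ext_get (by simp [deg]) fun j h1 h2 => ?_
  rw [List.get_ofFn]
  rw [List.length_map] at h2
  refine (L.eval_nbrFeat hN x s k.castSucc v ⟨j, h2⟩).trans ?_
  simp

end Eval

/-! ### Correctness of the layerwise simulation -/

/-- The circuit families and activation functions of `L` are those of the first `d` layers of the
network `M`. -/
def Implements (M : RecCGNN) : Prop := ∀ k : Fin d,
  (fun x => (M.layer (k + 1) x).map fun y => [y]) = (L.R k).eval ∧ L.act k = M.act (k + 1)

variable {L} {M : RecCGNN} (hL : L.Implements M) (x : Fin N → ℝ)

include hL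

theorem Implements.mem_eval {k : Fin d} {m : ℕ} {z : Fin m → ℝ} {y : ℝ}
    (h : y ∈ M.layer (k + 1) (List.ofFn z)) : ∃ y' ∈ (L.R k m).eval z, fstOrZero y' = y := by
  have h1 : [y] ∈ (L.R k).eval (List.ofFn z) := by
    rw [← (hL k).1]
    exact Part.mem_map (fun y => [y]) h
  rw [RecFamily.eval_ofFn] at h1
  obtain ⟨y', hy', h2⟩ := (Part.mem_map_iff _).1 h1
  refine ⟨y', hy', ?_⟩
  -- The circuit returns the one-element list `[y]`, so it has exactly one output and the default
  -- value of `fstOrZero` plays no role.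
  have h3 : (L.R k m).out = 1 := by simpa using congrArg List.length h2
  rw [fstOrZero, dif_pos (by omega)]
  have h4 := List.getElem_of_eq h2 (i := 0) (by simp [h3])
  simpa using h4

theorem Implements.dom_iff {k : Fin d} {m : ℕ} {z : Fin m → ℝ} :
    (M.layer (k + 1) (List.ofFn z)).Dom ↔ ((L.R k m).eval z).Dom := by
  have h1 := congrFun (hL k).1 (List.ofFn z)
  rw [RecFamily.eval_ofFn] at h1
  exact iff_of_eq (congrArg Part.Dom h1)

/-- The simulation of the first `k` layers: the features become available at some time if they are
defined, and never otherwise. -/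
theorem Implements.simulation (k : Fin (d + 1)) :
    (∃ h ∈ M.relFeats (adjRel hN x) (fun v => x (featIdx hN v)) k, ∃ T,
      Control.FiresAt (fun t => (L.control hN).ev x t (L.ready hN k)) T ∧
      ∀ t, T ≤ t → ∀ v, (L.control hN).ev x t (L.feat hN k v) = h v) ∨
    (¬ (M.relFeats (adjRel hN x) (fun v => x (featIdx hN v)) k).Dom ∧
      ∀ t, (L.control hN).ev x t (L.ready hN k) = 0) := by
  induction k using Fin.induction with
  | zero =>
    exact Or.inl ⟨_, Part.mem_some _, 0, fun t => by simp [Control.ev, ready], fun t _ v => rfl⟩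
  | succ k ih =>
    have hready : ∀ t, (L.control hN).ev x t (L.ready hN k.succ) = ∏ v, (L.control hN).mem x t
        (Bank.flagReg (B := L.bank n) (k, v, deg hN x v) .done) := fun t => by
      change ∏ v, (L.select hN k .done v).eval _ = _
      exact Finset.prod_congr rfl fun v _ => L.eval_select hN x _ k .done v
    have hfeat : ∀ t v, (L.control hN).ev x t (L.feat hN k.succ v) =
        M.act (k + 1) ((L.control hN).mem x t
          (Bank.flagReg (B := L.bank n) (k, v, deg hN x v) .res)) := fun t v => by
      rw [← (hL k).2]
      exact congrArg (L.act k) (L.eval_select hN x _ k .res v)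
    rcases ih with ⟨h, hh, T, hT, hhT⟩ | ⟨hdom, h0⟩
    · have hargs : ∀ v, List.ofFn (fun j => (L.control hN).ev x T
          ((L.control hN).arg (k, v, deg hN x v) j)) =
          h v :: (relNbrs (adjRel hN x) v).map h := fun v => by
        refine (L.ofFn_eval_arg hN x _ k v).trans ?_
        have h1 : (fun w => (L.feat hN k.castSucc w).eval
            (Sum.elim x ((L.control hN).mem x T))) = h := funext fun w => hhT T le_rfl w
        rw [← h1]
      have hstart : ∀ v, Control.FiresAt (fun t => (L.control hN).ev x t
          ((L.control hN).start (k, v, deg hN x v))) T := fun v => hT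
      have hstep : M.relFeats (adjRel hN x) (fun v => x (featIdx hN v)) k.succ =
          M.relStep (adjRel hN x) (k + 1) h := by
        change Part.bind (M.relFeats _ _ k.castSucc) _ = _
        rw [Part.eq_some_iff.2 hh, Part.bind_some]
      rw [hstep]
      by_cases hd : (M.relStep (adjRel hN x) (k + 1) h).Dom
      · refine Or.inl ⟨_, Part.get_mem hd, ?_⟩
        have key : ∀ v, ∃ T', Control.FiresAt (fun t => (L.control hN).mem x t
            (Bank.flagReg (B := L.bank n) (k, v, deg hN x v) .done)) T' ∧
            ∀ t, T' ≤ t → (L.control hN).mem x t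
              (Bank.flagReg (B := L.bank n) (k, v, deg hN x v) .res) =
              (M.layer (k + 1) (h v :: (relNbrs (adjRel hN x) v).map h)).get (hd v) := fun v => by
          have h1 : (M.layer (k + 1) (h v :: (relNbrs (adjRel hN x) v).map h)).get (hd v) ∈
              M.layer (k + 1) (List.ofFn fun j => (L.control hN).ev x T
                ((L.control hN).arg (k, v, deg hN x v) j)) :=
            (hargs v).symm ▸ Part.get_mem (hd v)
          obtain ⟨y', hy', h2⟩ := hL.mem_eval h1
          obtain ⟨T', h3, h4⟩ := (L.control hN).exists_done (hstart v) hy'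
          refine ⟨T', h3, fun t ht => (h4 t ht).trans h2⟩
        choose T' h1 h2 using key
        -- A product of flags that each switch once from `0` to `1` switches at the latest of their
        -- times. Without vertices the empty product is `1` from time `0`, in accordance with the
        -- empty supremum.
        refine ⟨Finset.univ.sup T', fun t => ?_, fun t ht v => ?_⟩
        · simp only [hready]
          split_ifs with ht
          · refine Finset.prod_eq_one fun v _ => (h1 v t).trans (if_pos ?_)
            exact (Finset.le_sup (Finset.mem_univ v)).trans ht
          · rw [Finset.sup_le_iff] at ht
            push Not at ht
            obtain ⟨v, hv, hlt⟩ := ht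
            exact Finset.prod_eq_zero hv ((h1 v t).trans (if_neg (by omega)))
        · rw [hfeat, h2 v t ((Finset.le_sup (Finset.mem_univ v)).trans ht)]
          rfl
      · refine Or.inr ⟨hd, fun t => ?_⟩
        -- One vertex with a diverging layer computation keeps its flag, and hence the product, at
        -- `0` forever.
        obtain ⟨v, hv⟩ := not_forall.1 hd
        rw [← hargs v, hL.dom_iff] at hv
        rw [hready]
        exact Finset.prod_eq_zero (Finset.mem_univ v)
          ((L.control hN).done_eq_zero (hstart v) hv t)
    · refine Or.inr ⟨fun hd => hdom hd.1, fun t => ?_⟩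
      -- Blocking needs a vertex, since an empty product would be `1`; without vertices every layer
      -- is vacuously defined, contradicting `hdom`.
      rcases isEmpty_or_nonempty (Fin n) with he | ⟨⟨v⟩⟩
      · exact (hdom (M.relFeats_dom (fun i g v => isEmptyElim v) _ _)).elim
      · rw [hready]
        exact Finset.prod_eq_zero (Finset.mem_univ v)
          ((L.control hN).done_eq_zero_of_start h0 t)

theorem Implements.eval_toRec {A : Set (ℝ → ℝ)} {W c D : ℕ} (hB : (L.bank n).Ok A W D)
    (hK : (L.control hN).Ok A W c) :
    (Control.toRec hB hK).eval x =
      (M.relFeats (adjRel hN x) (fun v => x (featIdx hN v)) d).map fun h =>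
        Fin.append (fun a => x (Fin.castLE ((Nat.le_add_right _ _).trans hN) a)) h := by
  rcases hL.simulation hN x (Fin.last d) with ⟨h, hh, T, hT, hhT⟩ | ⟨hdom, h0⟩
  · rw [Control.eval_toRec_of_firesAt hB hK hT]
    have hh' : M.relFeats (adjRel hN x) (fun v => x (featIdx hN v)) d = Part.some h :=
      Part.eq_some_iff.2 hh
    rw [hh', Part.map_some]
    congr 1
    funext j
    refine Fin.addCases (fun a => ?_) (fun v => ?_) j
    · simp [control, Control.ev]
    · simp only [control, Fin.append_right]
      exact hhT T le_rfl v
  · rw [Control.eval_toRec_of_forall hB hK h0]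
    have h1 : M.relFeats (adjRel hN x) (fun v => x (featIdx hN v)) d = Part.none :=
      Part.eq_none_iff'.2 hdom
    rw [h1, Part.map_none]

end Layers

/-! ### Bounds for size and depth -/

/-- Functions bounded by a polynomial. -/
def PolyBdd (f : ℕ → ℕ) : Prop := ∃ K q : ℕ, ∀ n, f n ≤ K * (n + 1) ^ q

namespace PolyBdd

variable {f g : ℕ → ℕ}

theorem mono (hg : PolyBdd g) (h : ∀ n, f n ≤ g n) : PolyBdd f := by
  obtain ⟨K, q, hK⟩ := hg
  exact ⟨K, q, fun n => (h n).trans (hK n)⟩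

theorem const (k : ℕ) : PolyBdd fun _ => k := ⟨k, 0, fun n => by simp⟩

theorem id : PolyBdd fun n => n := ⟨1, 1, fun n => by simp⟩

theorem add (hf : PolyBdd f) (hg : PolyBdd g) : PolyBdd fun n => f n + g n := by
  obtain ⟨K, q, hK⟩ := hf
  obtain ⟨K', q', hK'⟩ := hg
  refine ⟨K + K', q + q', fun n => ?_⟩
  have h1 : (n + 1) ^ q ≤ (n + 1) ^ (q + q') := Nat.pow_le_pow_right (by omega) (by omega)
  have h2 : (n + 1) ^ q' ≤ (n + 1) ^ (q + q') := Nat.pow_le_pow_right (by omega) (by omega)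
  rw [Nat.add_mul]
  exact Nat.add_le_add ((hK n).trans (Nat.mul_le_mul_left _ h1))
    ((hK' n).trans (Nat.mul_le_mul_left _ h2))

theorem mul (hf : PolyBdd f) (hg : PolyBdd g) : PolyBdd fun n => f n * g n := by
  obtain ⟨K, q, hK⟩ := hf
  obtain ⟨K', q', hK'⟩ := hg
  refine ⟨K * K', q + q', fun n => (Nat.mul_le_mul (hK n) (hK' n)).trans_eq ?_⟩
  ring

theorem pow (hf : PolyBdd f) (k : ℕ) : PolyBdd fun n => f n ^ k := by
  induction k with
  | zero => simpa using const 1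
  | succ k ih => simpa only [pow_succ] using ih.mul hf

theorem sum {ι : Type} (s : Finset ι) {f : ι → ℕ → ℕ} (h : ∀ i, PolyBdd (f i)) :
    PolyBdd fun n => ∑ i ∈ s, f i n := by
  classical
  induction s using Finset.induction_on with
  | empty => simpa using const 0
  | insert a s ha ih => simpa only [Finset.sum_insert ha] using (h a).add ih

end PolyBdd

/-- The bounding function for depths. -/
def logPow (i n : ℕ) : ℝ := (1 + Real.log (n + 1)) ^ i

theorem log_succ_nonneg (n : ℕ) : 0 ≤ Real.log ((n : ℝ) + 1) :=
  Real.log_nonneg (by simp)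

theorem one_le_logPow (i n : ℕ) : 1 ≤ logPow i n :=
  one_le_pow₀ (by linarith [log_succ_nonneg n])

/-- The logarithm of a polynomial is linear in the logarithm. This controls the depth of halting
circuits, whose number of inputs is only polynomially bounded in the input length. -/
theorem PolyBdd.logPow_le {P : ℕ → ℕ} (hP : PolyBdd P) (i : ℕ) :
    ∃ C : ℝ, 0 ≤ C ∧ ∀ n m, m ≤ P n → logPow i m ≤ C * logPow i n := by
  obtain ⟨K, q, hK⟩ := hP.add (PolyBdd.const 1)
  have hK0 : (1 : ℝ) ≤ K := by
    have := hK 0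
    simp only [zero_add, one_pow, mul_one] at this
    exact_mod_cast (by omega : 1 ≤ K)
  have hlogK := Real.log_nonneg hK0
  refine ⟨(1 + Real.log K + q) ^ i, by positivity, fun n m hm => ?_⟩
  rw [logPow, logPow, ← mul_pow]
  have h0 := log_succ_nonneg n
  have h1 : ((m : ℝ) + 1) ≤ K * ((n : ℝ) + 1) ^ q := by
    exact_mod_cast (Nat.succ_le_succ hm).trans (hK n)
  have h2 : Real.log ((m : ℝ) + 1) ≤ Real.log K + q * Real.log ((n : ℝ) + 1) := by
    refine (Real.log_le_log (by positivity) h1).trans_eq ?_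
    rw [Real.log_mul (by positivity) (by positivity), Real.log_pow]
  refine pow_le_pow_left₀ (by linarith [log_succ_nonneg m]) ?_ i
  have h3 : 0 ≤ Real.log K * Real.log ((n : ℝ) + 1) := mul_nonneg hlogK h0
  have h4 : (0 : ℝ) ≤ q := Nat.cast_nonneg q
  nlinarith

theorem exists_bound_of_isBigO {f : ℕ → ℕ} {g b : ℕ → ℝ}
    (h : (fun n => (f n : ℝ)) =O[atTop] g) (hb : ∀ n, 1 ≤ b n) (hgb : ∀ n, |g n| ≤ b n) :
    ∃ K : ℕ, ∀ n, (f n : ℝ) ≤ K * b n := by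
  obtain ⟨c, hc⟩ := h.bound
  obtain ⟨n₀, hn₀⟩ := eventually_atTop.1 hc
  obtain ⟨K, hK⟩ := exists_nat_ge (max c 0)
  -- The finitely many values below the threshold are absorbed into the constant, which works
  -- because `b` is at least `1`.
  refine ⟨K + ∑ j ∈ Finset.range n₀, f j, fun n => ?_⟩
  push_cast
  have h0 := hb n
  have hK0 : (0 : ℝ) ≤ K := Nat.cast_nonneg K
  have hs : (0 : ℝ) ≤ ∑ j ∈ Finset.range n₀, (f j : ℝ) :=
    Finset.sum_nonneg fun j _ => Nat.cast_nonneg _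
  rcases Nat.lt_or_ge n n₀ with hn | hn
  · have h1 : (f n : ℝ) ≤ ∑ j ∈ Finset.range n₀, (f j : ℝ) :=
      Finset.single_le_sum (f := fun j => (f j : ℝ)) (fun j _ => Nat.cast_nonneg _)
        (Finset.mem_range.2 hn)
    nlinarith [mul_nonneg hK0 (zero_le_one.trans h0), mul_nonneg hs (sub_nonneg.2 h0)]
  · have h1 := hn₀ n hn
    rw [Real.norm_natCast, Real.norm_eq_abs] at h1
    have h2 : c * |g n| ≤ K * b n :=
      mul_le_mul ((le_max_left _ _).trans hK) (hgb n) (abs_nonneg _) hK0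
    nlinarith [mul_nonneg hs (zero_le_one.trans h0)]

theorem ExtFamily.IsFamilyOf.polyBdd_size {F : ExtFamily} {𝔉 : CircuitClass}
    (h : F.IsFamilyOf 𝔉) : PolyBdd fun n => (F.circ n).size := by
  obtain ⟨q, hq⟩ := h.1
  obtain ⟨K, hK⟩ := exists_bound_of_isBigO (b := fun n => ((n : ℝ) + 1) ^ q) hq
    (fun n => one_le_pow₀ (by simp)) fun n => by
      rw [abs_of_nonneg (by positivity)]
      exact pow_le_pow_left₀ (Nat.cast_nonneg n) (by simp) q
  exact ⟨K, q, fun n => by exact_mod_cast hK n⟩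

theorem ExtFamily.IsFamilyOf.depth_le {F : ExtFamily} {𝔉 : CircuitClass}
    (h : F.IsFamilyOf 𝔉) :
    ∃ K : ℕ, ∀ n, ((F.circ n).depth : ℝ) ≤ K * logPow 𝔉.depthExp n :=
  exists_bound_of_isBigO h.2.1 (one_le_logPow _) fun n => by
    rw [abs_pow, abs_of_nonneg (Real.log_natCast_nonneg n)]
    refine pow_le_pow_left₀ (Real.log_natCast_nonneg n) ?_ _
    rcases Nat.eq_zero_or_pos n with rfl | hn
    · simp
    · have h1 : Real.log n ≤ Real.log ((n : ℝ) + 1) :=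
        Real.log_le_log (by exact_mod_cast hn) (by simp)
      linarith

theorem ExtFamily.isFamilyOf_of_bounds {F : ExtFamily} {𝔉 : CircuitClass}
    (hsize : PolyBdd fun n => (F.circ n).size) {C : ℝ}
    (hdepth : ∀ n, ((F.circ n).depth : ℝ) ≤ C * logPow 𝔉.depthExp n)
    (huses : ∀ n, (F.circ n).UsesOnly 𝔉.gates) : F.IsFamilyOf 𝔉 := by
  refine ⟨?_, ?_, huses⟩
  · obtain ⟨K, q, hK⟩ := hsize
    refine ⟨q, IsBigO.of_bound (K * 2 ^ q) (eventually_atTop.2 ⟨1, fun n hn => ?_⟩)⟩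
    rw [Real.norm_natCast, Real.norm_of_nonneg (by positivity), mul_assoc, ← mul_pow]
    have h1 : ((F.circ n).size : ℝ) ≤ K * ((n : ℝ) + 1) ^ q := by exact_mod_cast hK n
    refine h1.trans (mul_le_mul_of_nonneg_left ?_ (Nat.cast_nonneg K))
    have h2 : (1 : ℝ) ≤ n := by exact_mod_cast hn
    exact pow_le_pow_left₀ (by positivity) (by linarith) q
  -- From `n = 3` on, `log n ≥ 1` because `e < 3`, and `n + 1 ≤ n ^ 2`; so `1 + log (n + 1) ≤ 3 *
  -- log n`.
  · refine IsBigO.of_bound (|C| * 3 ^ 𝔉.depthExp) (eventually_atTop.2 ⟨3, fun n hn => ?_⟩)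
    have hn3 : (3 : ℝ) ≤ n := by exact_mod_cast hn
    have hlog1 : 1 ≤ Real.log n := by
      rw [Real.le_log_iff_exp_le (by linarith)]
      exact (Real.exp_one_lt_d9.le.trans (by norm_num)).trans hn3
    have hlog2 : Real.log ((n : ℝ) + 1) ≤ 2 * Real.log n := by
      have : Real.log ((n : ℝ) + 1) ≤ Real.log ((n : ℝ) ^ 2) :=
        Real.log_le_log (by linarith) (by nlinarith)
      rwa [Real.log_pow, Nat.cast_ofNat] at this
    rw [Real.norm_natCast, Real.norm_of_nonneg (by positivity), mul_assoc, ← mul_pow]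
    refine (hdepth n).trans ?_
    refine (mul_le_mul_of_nonneg_right (le_abs_self C)
      (zero_le_one.trans (one_le_logPow _ n))).trans ?_
    refine mul_le_mul_of_nonneg_left ?_ (abs_nonneg C)
    exact pow_le_pow_left₀ (by linarith [log_succ_nonneg n]) (by linarith) _

/-! ### The halting circuits -/

/-- A single formula computing the sign of the last input. -/
abbrev signNetlist (k : ℕ) : Netlist k 0 1 where
  Wire := Unit
  fintypeWire := inferInstance
  form _ := if h : 0 < k then .func sgn (.var (.inl ⟨k - 1, by omega⟩)) else .const 0
  lev _ := 0
  out _ := ()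

theorem signNetlist_ok {A : Set (ℝ → ℝ)} (hA : sgn ∈ A) (k : ℕ) : (signNetlist k).Ok A 0 1 0 := by
  refine ⟨fun _ => ?_, fun _ => le_rfl⟩
  change Formula.Ok A 0 _ 1 (if h : 0 < k then _ else _)
  split_ifs
  · exact Formula.ok_func hA (Formula.ok_var trivial)
  · exact Formula.ok_const 0

/-- A circuit computing the sign of its last input. -/
def signCircuit {A : Set (ℝ → ℝ)} (hA : sgn ∈ A) (k : ℕ) : ExtCircuit k 0 1 :=
  (signNetlist_ok hA k).toCircuit

theorem isFamilyOf_signCircuit {𝔉 : CircuitClass} (hA : sgn ∈ 𝔉.gates) :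
    ExtFamily.IsFamilyOf ⟨fun _ => 0, fun _ => 1, signCircuit hA⟩ 𝔉 := by
  refine ExtFamily.isFamilyOf_of_bounds (C := 4)
    ((PolyBdd.id.add (PolyBdd.const 5)).mono fun n => ?_) (fun n => ?_) fun n => ?_
  · have h := (signNetlist_ok hA n).size_le
    simp only [Fintype.card_unit] at h
    exact h.trans (by omega)
  · have h : (signCircuit hA n).depth ≤ 4 := (signNetlist_ok hA n).depth_le
    have h1 : ((signCircuit hA n).depth : ℝ) ≤ 4 := by exact_mod_cast h
    have h2 := one_le_logPow 𝔉.depthExp n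
    change ((signCircuit hA n).depth : ℝ) ≤ _
    linarith
  · exact (signNetlist_ok hA n).usesOnly

/-- Only the member with two inputs matters: iteration number first, then the single halting gate.
-/
theorem eval_signCircuit {A : Set (ℝ → ℝ)} (hA : sgn ∈ A) (x : Fin 2 → ℝ) :
    (signCircuit hA 2).eval x Fin.elim0 0 = sgn (x 1) :=
  (signNetlist_ok hA 2).eval_toCircuit (w := fun _ => sgn (x 1)) (fun _ => rfl) 0

/-! ### The circuit family simulating a network -/

namespace Bank

/-- The maximal size of the circuits of a family and of their halting circuits. -/
def maxSize (B : Bank) : ℕ := Finset.univ.sup fun i => max (B.Q i).C.size (B.H i).size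

/-- The maximal depth of the circuits of a family and of their halting circuits. -/
def maxDepth (B : Bank) : ℕ := Finset.univ.sup fun i => max (B.Q i).C.depth (B.H i).depth

theorem ok_of_usesOnly {B : Bank} {A : Set (ℝ → ℝ)} (h1 : ∀ i, (B.Q i).C.UsesOnly A)
    (h2 : ∀ i, (B.H i).UsesOnly A) {W : ℕ} (hW : B.maxSize ≤ W) : B.Ok A W B.maxDepth where
  usesOnly := h1
  usesOnly_halt := h2
  size i := ((le_max_left _ _).trans
    (Finset.le_sup (f := fun i => max (B.Q i).C.size (B.H i).size) (Finset.mem_univ i))).trans hW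
  size_halt i := ((le_max_right _ _).trans
    (Finset.le_sup (f := fun i => max (B.Q i).C.size (B.H i).size) (Finset.mem_univ i))).trans hW
  depth i := (le_max_left _ _).trans
    (Finset.le_sup (f := fun i => max (B.Q i).C.depth (B.H i).depth) (Finset.mem_univ i))
  depth_halt i := (le_max_right _ _).trans
    (Finset.le_sup (f := fun i => max (B.Q i).C.depth (B.H i).depth) (Finset.mem_univ i))

end Bank

namespace Layers

variable {d : ℕ} {L : Layers d}

theorem ok_isEq {V : Type} {A : Set (ℝ → ℝ)} {W c : ℕ} {P : V → Prop} (hs : sgn ∈ A)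
    {F : Formula V} (hF : F.Ok A W P c) (j : ℕ) : (isEq F j).Ok A W P (c + 4) :=
  (Formula.ok_func hs (hF.sub (Formula.ok_const _))).mul
    (Formula.ok_func hs (Formula.Ok.sub (Formula.ok_const _) hF))

/-- The depth `11` adds up as follows: an edge `1`, the degree `2`, the equality test `6`, the mask
`7`, `select` `8`, activation or product over vertices `9`, the product in `nbrFeat` `10`, its sum
`11`. -/
theorem ok_control {n N : ℕ} (hN : n * n + n ≤ N) {A : Set (ℝ → ℝ)} (hs : sgn ∈ A)
    (hact : ∀ k, L.act k ∈ A) {W : ℕ} (hW : n ≤ W) : (L.control hN).Ok A W 11 := by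
  have hedge : ∀ v w c, (L.edge hN v w).Ok A W (fun _ => True) (c + 1) := fun v w c =>
    Formula.ok_func hs (Formula.ok_var trivial)
  have hn : Fintype.card (Fin n) ≤ W + 2 := by
    rw [Fintype.card_fin]
    omega
  have hn1 : Fintype.card (Fin (n + 1)) ≤ W + 2 := by
    rw [Fintype.card_fin]
    omega
  have hsel : ∀ k f v, (L.select hN k f v).Ok A W (fun _ => True) 8 := fun k f v =>
    Formula.ok_sum hn1 fun δ =>
      (ok_isEq hs (Formula.ok_sum hn fun w => hedge v w 0) δ).mul (Formula.ok_var trivial)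
  have hfeat : ∀ k v, (L.feat hN k v).Ok A W (fun _ => True) 9 := by
    intro k v
    refine Fin.cases ?_ (fun k => ?_) k
    · exact Formula.ok_var trivial
    · exact Formula.ok_func (hact k) (hsel k _ v)
  have hready : ∀ k, (L.ready hN k).Ok A W (fun _ => True) 9 := by
    intro k
    refine Fin.cases ?_ (fun k => ?_) k
    · exact Formula.ok_const 1
    · exact Formula.ok_prod hn fun v => hsel k _ v
  have hnbr : ∀ k v j, (L.nbrFeat hN k v j).Ok A W (fun _ => True) 11 := by
    intro k v j
    refine Formula.ok_sum hn fun w => Formula.Ok.mul (Formula.Ok.mul (hedge v w 7) ?_) (hfeat k w)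
    refine (ok_isEq hs (c := 2) (Formula.ok_sum hn fun w' => ?_) j).deepen (by omega)
    split_ifs
    · exact hedge v w' 0
    · exact Formula.ok_const 0
  refine ⟨fun i => (hready i.1.castSucc).deepen (by omega), fun i j => ?_, fun j => ?_,
    (hready (Fin.last d)).deepen (by omega)⟩
  · refine Fin.cases ?_ (fun j => ?_) j
    · exact (hfeat i.1.castSucc i.2.1).deepen (by omega)
    · exact hnbr _ _ _
  · refine Fin.addCases (fun a => ?_) (fun v => ?_) j
    · simp only [control, Fin.append_left]
      exact Formula.ok_var trivial
    · simp only [control, Fin.append_right]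
      exact (hfeat _ _).deepen (by omega)

/-- The number of vertices of a graph whose encoding has length `N`. -/
def vertexCount (N : ℕ) : ℕ := Nat.findGreatest (fun n => n * n + n ≤ N) N

theorem vertexCount_spec (N : ℕ) : vertexCount N * vertexCount N + vertexCount N ≤ N :=
  Nat.findGreatest_spec (P := fun n => n * n + n ≤ N) (Nat.zero_le N) (Nat.zero_le N)

theorem vertexCount_le (N : ℕ) : vertexCount N ≤ N := Nat.findGreatest_le N

theorem vertexCount_eq (n : ℕ) : vertexCount (n * n + n) = n := by
  refine le_antisymm ?_ (Nat.le_findGreatest (by omega) le_rfl)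
  by_contra! h
  have h1 := vertexCount_spec (n * n + n)
  nlinarith

/-- The functions used by the circuits of the layers, the activation functions and the sign are in
`A`. -/
structure Uses (L : Layers d) (A : Set (ℝ → ℝ)) : Prop where
  sgn : sgn ∈ A
  act : ∀ k, L.act k ∈ A
  circuit : ∀ k n, (L.R k n).C.UsesOnly A
  halt : ∀ k n, (L.H k n).UsesOnly A

variable {A : Set (ℝ → ℝ)} (hA : L.Uses A)

include hA

theorem Uses.ok_bank (n : ℕ) :
    (L.bank n).Ok A ((L.bank n).maxSize + n + 1) (L.bank n).maxDepth :=
  Bank.ok_of_usesOnly (fun _ => hA.circuit _ _) (fun _ => hA.halt _ _) (by omega)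

theorem Uses.ok_control (N : ℕ) : (L.control (vertexCount_spec N)).Ok A
    ((L.bank (vertexCount N)).maxSize + vertexCount N + 1) 11 :=
  Layers.ok_control _ hA.sgn hA.act (by omega)

/-- The family of recurrent circuits simulating a network. -/
def Uses.family : RecFamily := fun N => Control.toRec (hA.ok_bank (vertexCount N)) (hA.ok_control N)

theorem Uses.haltsIn_family {𝔉 : CircuitClass} (h𝔉 : RecGNN.sgn ∈ 𝔉.gates) :
    hA.family.HaltsIn 𝔉 := by
  refine ⟨signCircuit h𝔉, isFamilyOf_signCircuit h𝔉, fun n i v _ => ?_⟩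
  refine (eval_signCircuit h𝔉 _).trans ?_
  have h : ∀ r : ℝ, RecGNN.sgn r = if decide (0 < r) = true then 1 else 0 := fun r => by
    simp [RecGNN.sgn]
  exact h (v (0 : Fin 1))

/-- The vertex count is a separate variable `n` tied by an equation, since for encodings it equals
the number of vertices only propositionally. -/
theorem Uses.eval_family {M : RecCGNN} (hL : L.Implements M) {N n : ℕ} (hn : vertexCount N = n)
    (hN : n * n + n ≤ N) (x : Fin N → ℝ) :
    hA.family.eval (List.ofFn x) =
      (M.relFeats (adjRel hN x) (fun v => x (featIdx hN v)) d).map fun h => List.ofFn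
        (Fin.append (fun a => x (Fin.castLE ((Nat.le_add_right _ _).trans hN) a)) h) := by
  subst hn
  rw [RecFamily.eval_ofFn]
  refine (congrArg (Part.map List.ofFn) (hL.eval_toRec hN x (hA.ok_bank _)
    (hA.ok_control N))).trans ?_
  rw [Part.map_map]
  rfl

/-- On a tuple that encodes no graph, the circuit still simulates the network on the directed graph
read off from it, and total layer functions terminate there too. -/
theorem Uses.dom_eval_family {M : RecCGNN} (hL : L.Implements M)
    (hM : ∀ i x, (M.layer i x).Dom) (x : List ℝ) : (hA.family.eval x).Dom := by
  have h := hA.eval_family hL rfl (vertexCount_spec x.length) x.get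
  rw [List.ofFn_get] at h
  rw [h]
  exact M.relFeats_dom (fun i g v => hM _ _) _ _

omit hA

/-! ### Encodings of graphs as inputs -/

open Classical in
theorem encode_eq_ofFn (G : LGraph) : G.encode = List.ofFn
    (Fin.append (fun a : Fin (G.card * G.card) =>
      if G.graph.Adj a.divNat a.modNat then (1 : ℝ) else 0) G.feat) := by
  rw [List.ofFn_fin_append, List.ofFn_mul, LGraph.encode, List.flatMap_def, List.ofFn_eq_map,
    List.ofFn_eq_map]
  congr 2
  refine List.map_congr_left fun v _ => ?_
  rw [List.ofFn_eq_map]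
  refine List.map_congr_left fun w _ => ?_
  have h := (finProdFinEquiv (m := G.card) (n := G.card)).symm_apply_apply (v, w)
  have h1 : (⟨(v : ℕ) * G.card + w, by
      have := (finProdFinEquiv (v, w)).2
      simp only [finProdFinEquiv_apply_val] at this
      nlinarith⟩ : Fin (G.card * G.card)) = finProdFinEquiv (v, w) := by
    ext
    simp [Nat.mul_comm, Nat.add_comm]
  rw [finProdFinEquiv_symm_apply, ← h1, Prod.mk.injEq] at h
  rw [h.1, h.2]

open Classical in
theorem Uses.eval_family_encode (hA : L.Uses A) {M : RecCGNN} (hL : L.Implements M) (G : LGraph) :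
    hA.family.eval G.encode = (M.relFeats G.graph.Adj G.feat d).map fun h =>
      LGraph.encode { G with feat := h } := by
  have h := hA.eval_family hL (vertexCount_eq G.card) le_rfl (Fin.append
    (fun a : Fin (G.card * G.card) => if G.graph.Adj a.divNat a.modNat then (1 : ℝ) else 0) G.feat)
  rw [← encode_eq_ofFn] at h
  rw [h]
  have h1 : adjRel le_rfl (Fin.append (fun a : Fin (G.card * G.card) =>
      if G.graph.Adj a.divNat a.modNat then (1 : ℝ) else 0) G.feat) = G.graph.Adj := by
    funext v w
    have h2 : adjIdx le_rfl v w = Fin.castAdd G.card (finProdFinEquiv (v, w)) := by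
      ext
      simp [adjIdx, Nat.mul_comm, Nat.add_comm]
    have h3 := (finProdFinEquiv (m := G.card) (n := G.card)).symm_apply_apply (v, w)
    rw [finProdFinEquiv_symm_apply, Prod.mk.injEq] at h3
    rw [adjRel, h2, Fin.append_left, h3.1, h3.2]
    by_cases h : G.graph.Adj v w <;> simp [h]
  have h2 : (fun v => Fin.append (fun a : Fin (G.card * G.card) =>
      if G.graph.Adj a.divNat a.modNat then (1 : ℝ) else 0) G.feat (featIdx le_rfl v)) = G.feat :=
    funext fun v => Fin.append_right _ _ v
  rw [h1, h2]
  congr 1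
  funext h
  rw [encode_eq_ofFn]
  congr 2
  funext a
  exact Fin.append_left _ _ a

/-- The simulating circuits have polynomial size, and the same depth exponent as the simulated
ones. -/
theorem Uses.isFamilyOf_family (hA : L.Uses A) {𝔉 𝔉' : CircuitClass}
    (hR : ∀ k, (L.R k).underlying.IsFamilyOf 𝔉)
    (hH : ∀ k, ExtFamily.IsFamilyOf ⟨fun _ => 0, fun _ => 1, L.H k⟩ 𝔉')
    (h𝔉 : 𝔉'.depthExp = 𝔉.depthExp) :
    hA.family.underlying.IsFamilyOf ⟨𝔉.depthExp, A⟩ := by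
  choose K q hK using fun k => (hR k).polyBdd_size
  choose K' q' hK' using fun k => (hH k).polyBdd_size
  choose E hE using fun k => (hR k).depth_le
  choose E' hE' using fun k => (hH k).depth_le
  simp only [h𝔉] at hE'
  -- `S` bounds the simulated circuits, whose arity is at most `N + 1`. `S'` bounds their halting
  -- circuits, whose number of inputs is at most `S N + 1`. Summing over the layers replaces a
  -- maximum.
  let S : ℕ → ℕ := fun N => ∑ k, K k * (N + 2) ^ q k
  let S' : ℕ → ℕ := fun N => ∑ k, K' k * (S N + 2) ^ q' k
  have hS : PolyBdd S := PolyBdd.sum _ fun k =>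
    (PolyBdd.const _).mul ((PolyBdd.id.add (PolyBdd.const 2)).pow _)
  have hS' : PolyBdd S' := PolyBdd.sum _ fun k =>
    (PolyBdd.const _).mul ((hS.add (PolyBdd.const 2)).pow _)
  have hsize : ∀ N k δ, δ ≤ N → (L.R k (δ + 1)).C.size ≤ S N := fun N k δ hδ =>
    ((hK k (δ + 1)).trans (Nat.mul_le_mul_left _ (Nat.pow_le_pow_left (by omega) _))).trans
      (Finset.single_le_sum (f := fun k => K k * (N + 2) ^ q k) (fun _ _ => Nat.zero_le _)
        (Finset.mem_univ k))
  have hnum : ∀ N k δ, δ ≤ N → (L.R k (δ + 1)).numHalt ≤ S N := fun N k δ hδ => by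
    -- Halting gates are distinct gates, so their number is bounded by the size of the circuit.
    have h := Fintype.card_le_of_injective _ (L.R k (δ + 1)).haltGate.injective
    rw [Fintype.card_fin] at h
    exact h.trans (hsize N k δ hδ)
  have hsize' : ∀ N k δ, δ ≤ N → (L.H k ((L.R k (δ + 1)).numHalt + 1)).size ≤ S' N :=
    fun N k δ hδ =>
    ((hK' k _).trans (Nat.mul_le_mul_left _ (Nat.pow_le_pow_left
      (Nat.add_le_add_right (hnum N k δ hδ) 2) _))).trans
      (Finset.single_le_sum (f := fun k => K' k * (S N + 2) ^ q' k) (fun _ _ => Nat.zero_le _)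
        (Finset.mem_univ k))
  have hidx : ∀ N (i : (L.bank (vertexCount N)).I), (i.2.2 : ℕ) ≤ N := fun N i =>
    (Nat.le_of_lt_succ i.2.2.2).trans (vertexCount_le N)
  have hmax : ∀ N, (L.bank (vertexCount N)).maxSize ≤ S N + S' N := fun N =>
    Finset.sup_le fun i _ => max_le
      ((hsize N i.1 i.2.2 (hidx N i)).trans (Nat.le_add_right _ _))
      ((hsize' N i.1 i.2.2 (hidx N i)).trans (Nat.le_add_left _ _))
  obtain ⟨C, hC0, hC⟩ := (PolyBdd.id.add (PolyBdd.const 1)).logPow_le 𝔉.depthExp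
  obtain ⟨C', hC0', hC'⟩ := (hS.add (PolyBdd.const 1)).logPow_le 𝔉.depthExp
  let Z : ℝ := ∑ k, (E k * C + E' k * C')
  have hZ : ∀ k, E k * C + E' k * C' ≤ Z := fun k =>
    Finset.single_le_sum (f := fun k => (E k : ℝ) * C + E' k * C') (fun _ _ => by positivity)
      (Finset.mem_univ k)
  have hZ0 : 0 ≤ Z := Finset.sum_nonneg fun _ _ => by positivity
  have hdepth : ∀ N, ((L.bank (vertexCount N)).maxDepth : ℝ) ≤ Z * logPow 𝔉.depthExp N := by
    intro N
    have hlog := zero_le_one.trans (one_le_logPow 𝔉.depthExp N)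
    have hmain : ∀ i : (L.bank (vertexCount N)).I,
        ((max ((L.bank (vertexCount N)).Q i).C.depth ((L.bank (vertexCount N)).H i).depth : ℕ) : ℝ)
          ≤ Z * logPow 𝔉.depthExp N := by
      intro i
      have h1 := (hE i.1 (i.2.2 + 1)).trans (mul_le_mul_of_nonneg_left
        (hC N (i.2.2 + 1) (Nat.succ_le_succ (hidx N i))) (Nat.cast_nonneg _))
      have h2 := (hE' i.1 ((L.R i.1 (i.2.2 + 1)).numHalt + 1)).trans (mul_le_mul_of_nonneg_left
        (hC' N _ (Nat.succ_le_succ (hnum N i.1 i.2.2 (hidx N i)))) (Nat.cast_nonneg _))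
      have h3 := mul_le_mul_of_nonneg_right (hZ i.1) hlog
      have h4 : 0 ≤ (E i.1 : ℝ) * (C * logPow 𝔉.depthExp N) := by positivity
      have h5 : 0 ≤ (E' i.1 : ℝ) * (C' * logPow 𝔉.depthExp N) := by positivity
      rw [Nat.cast_max]
      exact max_le (h1.trans (by linarith)) (h2.trans (by linarith))
    -- With no copies, for instance when there are no vertices, the maximal depth is `0` and no
    -- index attains it.
    rcases (Finset.univ : Finset (L.bank (vertexCount N)).I).eq_empty_or_nonempty with he | he
    · rw [Bank.maxDepth, he, Finset.sup_empty]
      simpa using mul_nonneg hZ0 hlog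
    · obtain ⟨i, -, hi⟩ := Finset.exists_mem_eq_sup _ he fun i =>
        max ((L.bank (vertexCount N)).Q i).C.depth ((L.bank (vertexCount N)).H i).depth
      rw [Bank.maxDepth, hi]
      exact hmain i
  -- The factor `18` is `11 + 7` from `Control.depth_toRec_le`; the summand `3` is absorbed because
  -- `logPow` is at least `1`.
  refine ExtFamily.isFamilyOf_of_bounds (C := (2 * Z + 3) * 18) ?_ (fun N => ?_) fun N =>
    Control.usesOnly_toRec (hA.ok_bank (vertexCount N)) (hA.ok_control N)
  · let W : ℕ → ℕ := fun N => S N + S' N + N + 1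
    have hW : PolyBdd W := ((hS.add hS').add PolyBdd.id).add (PolyBdd.const 1)
    -- A bound for the number of copies: layers, times vertices, times possible degrees.
    let J : ℕ → ℕ := fun N => d * (N * (N + 1))
    have hJ : PolyBdd J := (PolyBdd.const d).mul (PolyBdd.id.mul (PolyBdd.id.add (PolyBdd.const 1)))
    have hlin : ∀ a b, PolyBdd fun N => J N * (a * W N + b) := fun a b =>
      hJ.mul (((PolyBdd.const a).mul hW).add (PolyBdd.const b))
    refine PolyBdd.mono (g := fun N => N + J N * (2 * W N + 4) + N +
      (J N * (4 * W N + 4) + N + 1) * ((W N + 3) ^ 15 + 1)) ?_ fun N => ?_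
    · exact ((PolyBdd.id.add (hlin 2 4)).add PolyBdd.id).add
        ((((hlin 4 4).add PolyBdd.id).add (PolyBdd.const 1)).mul
          (((hW.add (PolyBdd.const 3)).pow 15).add (PolyBdd.const 1)))
    · have h := Control.size_toRec_le (hA.ok_bank (vertexCount N)) (hA.ok_control N) fun i => by
        have := i.2.2.2
        change (i.2.2 : ℕ) + 1 ≤ _
        omega
      have hv := vertexCount_le N
      have hW' : (L.bank (vertexCount N)).maxSize + vertexCount N + 1 ≤ W N :=
        Nat.succ_le_succ (Nat.add_le_add (hmax N) hv)
      have hJ' : Fintype.card (L.bank (vertexCount N)).I ≤ J N := by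
        simp only [Fintype.card_prod, Fintype.card_fin]
        exact Nat.mul_le_mul_left _ (Nat.mul_le_mul hv (Nat.succ_le_succ hv))
      refine h.trans ?_
      have hspec := vertexCount_spec N
      gcongr
  · have h : ((hA.family N).C.depth : ℝ) ≤
        (2 * ((L.bank (vertexCount N)).maxDepth : ℝ) + 3) * 18 := by
      exact_mod_cast Control.depth_toRec_le (hA.ok_bank (vertexCount N)) (hA.ok_control N)
    have h1 := hdepth N
    have h2 := one_le_logPow 𝔉.depthExp N
    refine h.trans ?_
    change _ ≤ (2 * Z + 3) * 18 * logPow 𝔉.depthExp N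
    nlinarith

end Layers

end RecGNN

theorem mainTheorem4 (𝔉 : RecGNN.CircuitClass) (A : Set (ℝ → ℝ)) (N : RecGNN.RecCGNN)
    (hN : N.IsInnerRecurrent 𝔉 A) :
    ∃ f ∈ RecGNN.RecClass 𝔉.withSign (𝔉.withSign.adjoin A),
      (∀ G : RecGNN.LGraph, f G.encode = (N.eval G).map RecGNN.LGraph.encode) ∧
      ((∀ i x, (N.layer i x).Dom) → ∀ x, (f x).Dom) := by
  obtain ⟨hlayer, hact, d, hd, hhalt⟩ := hN
  -- Layers of the network are numbered from `1`, hence the shift; only the first `d` of them are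
  -- simulated.
  choose R hR hRH hRe using fun k : Fin d => (hlayer (k + 1)).2
  choose H hH hHe using hRH
  let L : RecGNN.Layers d := ⟨R, H, hHe, fun k => N.act (k + 1)⟩
  have hsgn : RecGNN.sgn ∈ 𝔉.withSign.gates := Or.inr rfl
  have hA : L.Uses (𝔉.withSign.adjoin A).gates :=
    { sgn := Or.inl hsgn
      act := fun k => Or.inr (hact _)
      circuit := fun k n g f p h => Or.inl (Or.inl ((hR k).2.2 n g f p h))
      halt := fun k n g f p h => Or.inl ((hH k).2.2 n g f p h) }
  have hL : L.Implements N := fun k => ⟨hRe k, rfl⟩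
  refine ⟨hA.family.eval,
    ⟨hA.family, hA.isFamilyOf_family (𝔉 := 𝔉) hR hH rfl, hA.haltsIn_family hsgn, rfl⟩,
    fun G => ?_, hA.dom_eval_family hL⟩
  rw [hA.eval_family_encode hL, N.eval_eq hd hhalt, Part.map_map]
  rfl
end
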